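/- Let $k,d\ge 0$ be integers, let $A\subset\mathbb{R}^k$ be a bounded Borel set, and let $f$ be a map from $A$ to $\mathbb{R}^d$ that is injective and Lipschitz on $A$. For a linear map $L:\mathbb{R}^k\to\mathbb{R}^d$ put $J_kL=\sqrt{\det(L^*\circ L)}$, and let $J_kf(x)=J_k(df(x))$, where $df(x)$ is the derivative of $f$ relative to $A$; it exists and is unique for $\mathcal L^k$-almost every $x\in A$ and agrees there with the derivative of any Lipschitz extension of $f$. Let $\mathcal H^k$ be the $k$-dimensional Hausdorff measure on $\mathbb{R}^d$ with weights $w_k(\operatorname{diam}(S)/2)^k$, where $w_k=\pi^{k/2}/\Gamma(k/2+1)$. For a measure $\mu$ and a probability measure $\rho\ll\mu$ put $H_\mu(\rho)=\mathbb{E}_\rho\left[-\ln\frac{d\rho}{d\mu}\right]$. Let $\rho$ be a probability measure on $\mathbb{R}^k$ with $\rho\ll\mathcal L^k|_A$, and suppose that $J_kf>0$ $\rho$-almost everywhere. Then: 1. $f_*\rho\ll\mathcal H^k|_{f(A)}$. 2. $J_kf\circ f^{-1}>0$ holds $\mathcal H^k|_{f(A)}$-almost everywhere, and for every density $r$ of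 $\rho$ with respect to $\mathcal L^k|_A$, the function $(r/J_kf)\circ f^{-1}$, which is therefore well defined $\mathcal H^k|_{f(A)}$-almost everywhere, is a density of $f_*\rho$ with respect to $\mathcal H^k|_{f(A)}$. 3. $\ln J_kf$ is measurable up to a $\rho$-null set, the positive parts of the integrands defining $H_{\mathcal H^k|_{f(A)}}(f_*\rho)$, $H_{\mathcal L^k}(\rho)$ and $\mathbb{E}_\rho[\ln J_kf]$ have finite integral, so that these three quantities are well defined in $[-\infty,\infty)$, and $$H_{\mathcal H^k|_{f(A)}}(f_*\rho)=H_{\mathcal L^k}(\rho)+\mathbb{E}_\rho[\ln J_kf].$$ -/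

import Mathlib

open MeasureTheory Set
open scoped ENNReal NNReal

noncomputable section

namespace RectEntropy

/-- The volume `w_m = π^(m/2) / Γ(m/2 + 1)` of the unit ball of `ℝ^m`. -/
def ballVolume (m : ℝ) : ℝ := Real.pi ^ (m / 2) / Real.Gamma (m / 2 + 1)

/-- The `m`-dimensional Hausdorff measure with the normalization of geometric measure theory:
the weight of a covering set `S` is `w_m (diam S / 2)^m`. Mathlib's `μH[m]` is the same
construction with the weight `(diam S)^m`, so the two differ by the factor `w_m / 2^m`. -/
def hausdorff {X : Type*} [EMetricSpace X] [MeasurableSpace X] [BorelSpace X] (m : ℝ) :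
    Measure X :=
  ENNReal.ofReal (ballVolume m / 2 ^ m) • Measure.hausdorffMeasure m

/-- The `k`-dimensional Jacobian (area factor) `J_k L = √(det (L* ∘ L))`, with `k = dim V`. -/
def areaFactor {V W : Type*} [NormedAddCommGroup V] [InnerProductSpace ℝ V]
    [FiniteDimensional ℝ V] [NormedAddCommGroup W] [InnerProductSpace ℝ W]
    [FiniteDimensional ℝ W] (L : V →ₗ[ℝ] W) : ℝ :=
  Real.sqrt (LinearMap.det (LinearMap.adjoint L ∘ₗ L))

/-- The Jacobian `J_k f` of a map `f` considered on the set `A`, at the point `x`. It is the area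
factor of the derivative of `f` relative to `A`. If `f` is Lipschitz on the Borel set `A`, this
derivative exists and is unique at almost every point of `A`, and there it is the derivative of
every Lipschitz extension of `f|_A` to the whole space. -/
def jacobian {k d : ℕ} (f : EuclideanSpace ℝ (Fin k) → EuclideanSpace ℝ (Fin d))
    (A : Set (EuclideanSpace ℝ (Fin k))) (x : EuclideanSpace ℝ (Fin k)) : ℝ :=
  areaFactor (fderivWithin ℝ f A x : EuclideanSpace ℝ (Fin k) →ₗ[ℝ] EuclideanSpace ℝ (Fin d))

/-- The expectation `E_ρ[φ] = E_ρ[φ⁺] - E_ρ[φ⁻]`, as an extended real number. It is meaningful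
as soon as one of the two terms is finite. -/
def expectation {Ω : Type*} [MeasurableSpace Ω] (ρ : Measure Ω) (φ : Ω → ℝ) : EReal :=
  ((∫⁻ x, ENNReal.ofReal (φ x) ∂ρ : ℝ≥0∞) : EReal) -
    ((∫⁻ x, ENNReal.ofReal (-φ x) ∂ρ : ℝ≥0∞) : EReal)

/-- The integrand `-ln (dρ/dμ)` of the entropy. -/
def negLogDensity {Ω : Type*} [MeasurableSpace Ω] (μ ρ : Measure Ω) (x : Ω) : ℝ :=
  -Real.log (ρ.rnDeriv μ x).toReal

/-- The entropy `H_μ(ρ) = E_ρ[-ln (dρ/dμ)]`, as an extended real number. -/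
def entropy {Ω : Type*} [MeasurableSpace Ω] (μ ρ : Measure Ω) : EReal :=
  expectation ρ (negLogDensity μ ρ)

end RectEntropy

end

open RectEntropy

/-!
The theorem rests on the area formula: for an injective Lipschitz map `f` on `A` and measurable
`B ⊆ A`, the integral of `J_k f` over `B` is the Hausdorff measure of `f(B)`. Equivalently, `f`
pushes the measure `J_k f ℒ^k` on `A` forward to `ℋ^k` on `f(A)` (`map_withDensity_jacobian`). If
`ρ` has density `r` with respect to `ℒ^k` on `A` and lives where `J_k f > 0`, then it has density
`r / J_k f` with respect to `J_k f ℒ^k`, so that its image has the density `(r / J_k f) ∘ f⁻¹`;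
by the Lusin–Souslin theorem, `f` is a measurable embedding of `A`, which settles all questions of
measurability. Taking logarithms, `-ln ((r / J_k f) ∘ f⁻¹)` at `f x` is `-ln r(x) + ln J_k f(x)`,
and integrating against `ρ` gives the entropy formula. Additivity of the expectation is legitimate
since all the positive parts are integrable: those of the entropies because `-t ln t ≤ 1` and
the reference measures are finite, and that of `ln J_k f` because `J_k f ≤ C ^ k` almost everywhere,
which is the area formula compared with `ℋ^k(f(B)) ≤ C ^ k ℒ^k(B)`.

The area formula is proved in the following way.

* With the weights `w_k (diam S / 2)^k`, the Hausdorff measure on `ℝ^k` is the Lebesgue measure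
  (`hausdorff_eq_volume`). One inequality is the isodiametric inequality
  `volume_le_volume_closedBall_half_diam`, proved by Steiner symmetrization in each coordinate; the
  other one follows by covering the unit ball by disjoint small balls, up to a null set.
* A linear map `A` scales the Hausdorff measure by its area factor, in Mathlib `LinearMap.normDet`.
  A map on `s` which is close to `A` in the Lipschitz sense therefore scales it nearly by the same
  factor. If `A` is injective this is a comparison of Lipschitz constants; the upper bound for
  degenerate `A` is obtained by lifting the map `f` to `x ↦ (f x, ε x)`
  (`hausdorffMeasure_image_le_mul_of_normDet_lt`).
* By Rademacher's theorem and a countable partition, `f` is close to linear maps on measurable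
  pieces, and summing over the pieces gives the formula
  (`lintegral_normDet_eq_hausdorffMeasure_image`).
-/

open RectEntropy

/-! ### The isodiametric inequality -/

section Steiner

variable {ι : Type*} [DecidableEq ι]

/-- The Steiner symmetrization of `S ⊆ ℝ^ι` in the coordinate `i`: each section of `S` parallel to
the `i`-th axis is replaced by the open interval centred at `0` of the same length. -/
def steiner (i : ι) (S : Set (ι → ℝ)) : Set (ι → ℝ) :=
  {x | ENNReal.ofReal (2 * |x i|) < volume {t : ℝ | Function.update x i t ∈ S}}

lemma volume_section_eq_lmarginal (i : ι) {S : Set (ι → ℝ)} (hS : MeasurableSet S) :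
    (fun x : ι → ℝ => volume {t : ℝ | Function.update x i t ∈ S}) =
      ∫⋯∫⁻_{i}, S.indicator 1 ∂(fun _ => (volume : Measure ℝ)) := by
  rw [lmarginal_singleton]
  ext x
  have hm : MeasurableSet {t : ℝ | Function.update x i t ∈ S} := measurable_update x hS
  rw [← lintegral_indicator_one hm]
  rfl

lemma measurableSet_steiner (i : ι) {S : Set (ι → ℝ)} (hS : MeasurableSet S) :
    MeasurableSet (steiner i S) := by
  refine measurableSet_lt (by fun_prop) ?_
  rw [volume_section_eq_lmarginal i hS]
  exact (measurable_one.indicator hS).lmarginal _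

lemma volume_two_mul_abs_lt (m : ℝ≥0∞) :
    volume {t : ℝ | ENNReal.ofReal (2 * |t|) < m} = m := by
  rcases eq_or_ne m ∞ with rfl | hm
  · simp only [ENNReal.ofReal_lt_top, ofPred_true, measure_univ_of_isAddLeftInvariant]
  · have : {t : ℝ | ENNReal.ofReal (2 * |t|) < m} = Ioo (-(m.toReal / 2)) (m.toReal / 2) := by
      ext t
      rw [mem_ofPred_eq, ENNReal.ofReal_lt_iff_lt_toReal (by positivity) hm, mem_Ioo, ← abs_lt]
      constructor <;> intro h <;> linarith
    rw [this, Real.volume_Ioo, sub_neg_eq_add, add_halves, ENNReal.ofReal_toReal hm]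

lemma volume_steiner [Fintype ι] (i : ι) {S : Set (ι → ℝ)} (hS : MeasurableSet S) :
    volume (steiner i S) = volume S := by
  have hS' := measurableSet_steiner i hS
  rw [← lintegral_indicator_one hS', ← lintegral_indicator_one hS]
  refine lintegral_eq_of_lmarginal_eq {i} (measurable_one.indicator hS')
    (measurable_one.indicator hS) ?_
  rw [← volume_section_eq_lmarginal i hS', ← volume_section_eq_lmarginal i hS]
  ext x
  simp only [steiner, mem_ofPred_eq, Function.update_self, Function.update_idem]
  exact volume_two_mul_abs_lt _

/-- Two sets of reals of lengths larger than `2a` and `2b` contain points at distance at least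
`a + b`: if `p' < p` and `q' < q` nearly realize the lengths, then
`(p - q') + (q - p') > 2 (a + b)`. -/
lemma exists_le_abs_sub_of_lt_volume {P Q : Set ℝ} {a b : ℝ} (ha : 0 ≤ a) (hb : 0 ≤ b)
    (hP : ENNReal.ofReal (2 * a) < volume P) (hQ : ENNReal.ofReal (2 * b) < volume Q) :
    ∃ p ∈ P, ∃ q ∈ Q, a + b ≤ |p - q| := by
  have key : ∀ {T : Set ℝ} {c : ℝ}, 0 ≤ c → ENNReal.ofReal (2 * c) < volume T →
      ∃ u ∈ T, ∃ v ∈ T, 2 * c < u - v := by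
    intro T c hc hT
    by_contra! hcon
    refine absurd (Real.volume_le_diam T) (not_le.2 (lt_of_le_of_lt ?_ hT))
    refine Metric.ediam_le fun x hx y hy => ?_
    rw [edist_dist, Real.dist_eq]
    exact ENNReal.ofReal_le_ofReal (abs_le.2 ⟨by linarith [hcon y hy x hx], hcon x hx y hy⟩)
  obtain ⟨p, hp, p', hp', hpp⟩ := key ha hP
  obtain ⟨q, hq, q', hq', hqq⟩ := key hb hQ
  rcases le_total (a + b) (p - q') with h | h
  · exact ⟨p, hp, q', hq', h.trans (le_abs_self _)⟩
  · refine ⟨p', hp', q, hq, le_trans ?_ (neg_le_abs _)⟩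
    linarith

/-- Steiner symmetrization does not increase the Euclidean diameter. -/
lemma sum_sq_sub_le_of_mem_steiner [Fintype ι] (i : ι) {S : Set (ι → ℝ)} {D : ℝ}
    (hD : ∀ x ∈ S, ∀ y ∈ S, ∑ j, (x j - y j) ^ 2 ≤ D) :
    ∀ x ∈ steiner i S, ∀ y ∈ steiner i S, ∑ j, (x j - y j) ^ 2 ≤ D := by
  intro x hx y hy
  obtain ⟨p, hp, q, hq, hpq⟩ :=
    exists_le_abs_sub_of_lt_volume (abs_nonneg (x i)) (abs_nonneg (y i)) hx hy
  refine le_trans (Finset.sum_le_sum fun j _ => ?_) (hD _ hp _ hq)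
  rcases eq_or_ne j i with rfl | hj
  · simp only [Function.update_self]
    exact sq_le_sq.2 ((abs_sub (x j) (y j)).trans hpq)
  · simp [Function.update_of_ne hj]

/-- `S` is invariant under the reflection in the coordinate hyperplane `x i = 0`. -/
def IsReflectionInvariant (i : ι) (S : Set (ι → ℝ)) : Prop :=
  ∀ x ∈ S, Function.update x i (-x i) ∈ S

lemma isReflectionInvariant_steiner_self (i : ι) (S : Set (ι → ℝ)) :
    IsReflectionInvariant i (steiner i S) := by
  intro x hx
  simpa [steiner] using hx

lemma IsReflectionInvariant.steiner {i j : ι} (hij : j ≠ i) {S : Set (ι → ℝ)}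
    (hS : IsReflectionInvariant j S) : IsReflectionInvariant j (steiner i S) := by
  intro x hx
  refine lt_of_lt_of_le ?_ (measure_mono (μ := volume)
    (show {t : ℝ | Function.update x i t ∈ S} ⊆ _ from fun t ht => ?_))
  · simpa [Function.update_of_ne hij.symm, _root_.steiner] using hx
  · have := hS _ ht
    rwa [Function.update_of_ne hij, Function.update_comm hij.symm] at this

/-- Symmetrizing in one coordinate after the other keeps the symmetries already obtained. -/
lemma exists_isReflectionInvariant [Fintype ι] {S : Set (ι → ℝ)} (hS : MeasurableSet S) {D : ℝ}
    (hD : ∀ x ∈ S, ∀ y ∈ S, ∑ j, (x j - y j) ^ 2 ≤ D) (I : Finset ι) :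
    ∃ T : Set (ι → ℝ), MeasurableSet T ∧ volume T = volume S ∧
      (∀ x ∈ T, ∀ y ∈ T, ∑ j, (x j - y j) ^ 2 ≤ D) ∧ ∀ i ∈ I, IsReflectionInvariant i T := by
  induction I using Finset.induction with
  | empty => exact ⟨S, hS, rfl, hD, by simp⟩
  | insert i I hi ih =>
    obtain ⟨T, hT, hTS, hTD, hTI⟩ := ih
    refine ⟨steiner i T, measurableSet_steiner i hT, (volume_steiner i hT).trans hTS,
      sum_sq_sub_le_of_mem_steiner i hTD, fun j hj => ?_⟩
    rcases eq_or_ne j i with rfl | hji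
    · exact isReflectionInvariant_steiner_self j T
    · exact (hTI j (Finset.mem_of_mem_insert_of_ne hj hji)).steiner hji

lemma neg_mem_of_isReflectionInvariant [Fintype ι] {T : Set (ι → ℝ)}
    (hT : ∀ i, IsReflectionInvariant i T) {x : ι → ℝ} (hx : x ∈ T) : -x ∈ T := by
  have key : ∀ I : Finset ι, (fun i => if i ∈ I then -x i else x i) ∈ T := by
    intro I
    induction I using Finset.induction with
    | empty => simpa using hx
    | insert i I hi ih =>
      convert hT i _ ih using 1
      ext j
      rcases eq_or_ne j i with rfl | hji
      · simp [hi]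
      · simp [hji]
  convert key Finset.univ using 1
  ext i
  simp

end Steiner

/-- The **isodiametric inequality**: a set in Euclidean space has at most the volume of a ball of
the same diameter. Symmetrizing in all coordinates makes the set centrally symmetric, so that it
lies in the ball around `0` whose radius is half the diameter. -/
theorem volume_le_volume_closedBall_half_diam {ι : Type*} [Fintype ι]
    {S : Set (EuclideanSpace ℝ ι)} (hS : Bornology.IsBounded S) :
    volume S ≤ volume (Metric.closedBall (0 : EuclideanSpace ℝ ι) (Metric.diam S / 2)) := by
  classical
  set D := Metric.diam S
  have hdiam : ∀ x ∈ WithLp.toLp 2 ⁻¹' closure S, ∀ y ∈ WithLp.toLp 2 ⁻¹' closure S,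
      ∑ j : ι, ((x : ι → ℝ) j - y j) ^ 2 ≤ D ^ 2 := by
    intro x hx y hy
    have h := Metric.dist_le_diam_of_mem hS.closure hx hy
    rw [Metric.diam_closure, EuclideanSpace.dist_eq] at h
    have := Real.sqrt_le_iff.1 h
    simpa [Real.dist_eq, sq_abs] using this.2
  have hmeas : MeasurableSet (WithLp.toLp 2 ⁻¹' closure S : Set (ι → ℝ)) :=
    (PiLp.volume_preserving_toLp ι).measurable isClosed_closure.measurableSet
  obtain ⟨T, hT, hTS, hTD, hTI⟩ := exists_isReflectionInvariant hmeas hdiam Finset.univ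
  -- `x` and `-x` both lie in `T`, so `2 ‖x‖ ≤ D`
  have hsub : WithLp.ofLp ⁻¹' T ⊆ Metric.closedBall (0 : EuclideanSpace ℝ ι) (D / 2) := by
    intro x hx
    have hneg := neg_mem_of_isReflectionInvariant (fun i => hTI i (Finset.mem_univ i)) hx
    have h := hTD _ hx _ hneg
    have h4 : ∑ j : ι, (x j - (-(WithLp.ofLp x)) j) ^ 2 = 4 * ∑ j : ι, x j ^ 2 := by
      rw [Finset.mul_sum]
      refine Finset.sum_congr rfl fun j _ => ?_
      simp only [Pi.neg_apply]
      ring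
    rw [h4] at h
    rw [mem_closedBall_zero_iff, EuclideanSpace.norm_eq]
    refine Real.sqrt_le_iff.2 ⟨by positivity, ?_⟩
    simp only [Real.norm_eq_abs, sq_abs]
    nlinarith
  calc volume S ≤ volume (closure S) := measure_mono subset_closure
    _ = volume (WithLp.toLp 2 ⁻¹' closure S : Set (ι → ℝ)) :=
      ((PiLp.volume_preserving_toLp ι).measure_preimage
        isClosed_closure.measurableSet.nullMeasurableSet).symm
    _ = volume T := hTS.symm
    _ = volume (WithLp.ofLp ⁻¹' T : Set (EuclideanSpace ℝ ι)) :=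
      ((PiLp.volume_preserving_ofLp ι).measure_preimage hT.nullMeasurableSet).symm
    _ ≤ _ := measure_mono hsub

/-! ### Normalization of the Hausdorff measure -/

section Normalization

open Metric Filter Topology

lemma ballVolume_natCast_pos (k : ℕ) : 0 < ballVolume k :=
  div_pos (Real.rpow_pos_of_pos Real.pi_pos _) (Real.Gamma_pos_of_pos (by positivity))

lemma volume_closedBall_eq_ballVolume (k : ℕ) (x : EuclideanSpace ℝ (Fin k)) {r : ℝ}
    (hr : 0 ≤ r) :
    volume (closedBall x r) =
      ENNReal.ofReal (ballVolume k / 2 ^ k) * ENNReal.ofReal (2 * r) ^ k := by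
  have hmain : volume (closedBall x r) = ENNReal.ofReal r ^ k * ENNReal.ofReal (ballVolume k) := by
    rcases Nat.eq_zero_or_pos k with rfl | hk
    · have h1 : closedBall x r = {0} := by
        ext y
        simp [Subsingleton.elim y x, hr, Subsingleton.elim x 0]
      rw [h1, volume_euclideanSpace_eq_dirac]
      simp [ballVolume]
    · have : Nonempty (Fin k) := ⟨⟨0, hk⟩⟩
      rw [EuclideanSpace.volume_closedBall, Fintype.card_fin, ballVolume, Real.sqrt_eq_rpow,
        ← Real.rpow_natCast (Real.pi ^ (1 / 2 : ℝ)), ← Real.rpow_mul Real.pi_pos.le]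
      ring_nf
  rw [hmain, ← ENNReal.ofReal_pow hr, ← ENNReal.ofReal_pow (by positivity),
    ← ENNReal.ofReal_mul (by positivity),
    ← ENNReal.ofReal_mul (div_nonneg (ballVolume_natCast_pos k).le (by positivity))]
  congr 1
  rw [mul_pow]
  field_simp

lemma ediam_eq_ofReal_diam {X : Type*} [PseudoMetricSpace X] {S : Set X}
    (hS : Bornology.IsBounded S) : ediam S = ENNReal.ofReal (diam S) :=
  (ENNReal.ofReal_toReal hS.ediam_ne_top).symm

/-- By the isodiametric inequality, the weight of a set in the Hausdorff measure is at least its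
volume. -/
lemma volume_le_hausdorff (k : ℕ) :
    (volume : Measure (EuclideanSpace ℝ (Fin k))) ≤ hausdorff (k : ℝ) := by
  have hc : 0 < ballVolume k / 2 ^ k := div_pos (ballVolume_natCast_pos k) (by positivity)
  have hc0 : ENNReal.ofReal (ballVolume k / 2 ^ k) ≠ 0 := by simpa using hc
  have h : (ENNReal.ofReal (ballVolume k / 2 ^ k))⁻¹ •
      (volume : Measure (EuclideanSpace ℝ (Fin k))) ≤ Measure.hausdorffMeasure k := by
    refine Measure.le_hausdorffMeasure _ _ 1 one_pos fun S hS => ?_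
    have hb : Bornology.IsBounded S :=
      isBounded_iff_ediam_ne_top.2 (hS.trans_lt ENNReal.one_lt_top).ne
    rw [Measure.smul_apply, smul_eq_mul, ENNReal.inv_mul_le_iff hc0 ENNReal.ofReal_ne_top,
      ENNReal.rpow_natCast, ediam_eq_ofReal_diam hb]
    refine (volume_le_volume_closedBall_half_diam hb).trans_eq ?_
    rw [volume_closedBall_eq_ballVolume k _ (by positivity), mul_div_cancel₀ _ two_ne_zero]
  rw [hausdorff, Real.rpow_natCast]
  intro S
  have := h S
  rwa [Measure.smul_apply, smul_eq_mul, ENNReal.inv_mul_le_iff hc0 ENNReal.ofReal_ne_top] at this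

/-- Besicovitch's theorem covers almost all of the open unit ball by disjoint small closed balls,
for which the weight in the Hausdorff measure is their volume. -/
lemma hausdorff_ball_le_volume (k : ℕ) :
    (hausdorff (k : ℝ) : Measure (EuclideanSpace ℝ (Fin k))) (ball 0 1) ≤
      volume (ball (0 : EuclideanSpace ℝ (Fin k)) 1) := by
  set U : Set (EuclideanSpace ℝ (Fin k)) := ball 0 1
  set c := ENNReal.ofReal (ballVolume k / 2 ^ k) with hcdef
  have hHaar :
      (Measure.hausdorffMeasure (k : ℝ) : Measure (EuclideanSpace ℝ (Fin k))) ≪ volume := by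
    have : (Measure.hausdorffMeasure (Module.finrank ℝ (EuclideanSpace ℝ (Fin k)) : ℝ) :
        Measure (EuclideanSpace ℝ (Fin k))) ≪ volume :=
      Measure.absolutelyContinuous_isAddHaarMeasure _ _
    simpa using this
  have hcover : ∀ n : ℕ, ∃ t : Set (EuclideanSpace ℝ (Fin k) × ℝ), t.Countable ∧
      (∀ p ∈ t, 0 < p.2 ∧ p.2 < 1 / (n + 1) ∧ closedBall p.1 p.2 ⊆ U) ∧
      volume (U \ ⋃ (p : EuclideanSpace ℝ (Fin k) × ℝ) (_ : p ∈ t), closedBall p.1 p.2) = 0 ∧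
      t.PairwiseDisjoint fun p => closedBall p.1 p.2 := by
    intro n
    obtain ⟨t, htc, -, hf, hnull, hdisj⟩ := Besicovitch.exists_disjoint_closedBall_covering_ae_aux
      (volume : Measure (EuclideanSpace ℝ (Fin k)))
      (fun x => {r | 0 < r ∧ r < 1 / ((n : ℝ) + 1) ∧ closedBall x r ⊆ U}) U (by
        intro x hx δ hδ
        obtain ⟨ε, hε, hsub⟩ := nhds_basis_closedBall.mem_iff.1 (isOpen_ball.mem_nhds hx)
        have hn : 0 < 1 / ((n : ℝ) + 1) := by positivity
        refine ⟨min ε (min (δ / 2) (1 / ((n : ℝ) + 1) / 2)), ⟨by positivity, ?_, ?_⟩,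
          by positivity, ?_⟩
        · exact ((min_le_right _ _).trans (min_le_right _ _)).trans_lt (half_lt_self hn)
        · exact (closedBall_subset_closedBall (min_le_left _ _)).trans hsub
        · exact ((min_le_right _ _).trans (min_le_left _ _)).trans_lt (half_lt_self hδ))
    exact ⟨t, htc, hf, hnull, hdisj⟩
  choose t htc ht hnull hdisj using hcover
  have hcount : ∀ n, Countable (t n) := fun n => (htc n).to_subtype
  -- what the coverings miss is negligible for the Hausdorff measure too, which is a Haar measure
  set N : Set (EuclideanSpace ℝ (Fin k)) := ⋃ n, U \ ⋃ p : t n, closedBall p.1.1 p.1.2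
  have hN : Measure.hausdorffMeasure (k : ℝ) N = 0 := by
    refine hHaar (measure_iUnion_null fun n => ?_)
    rw [iUnion_subtype]
    exact hnull n
  have hdiam : ∀ (n : ℕ) (p : t n),
      ediam (closedBall p.1.1 p.1.2) ≤ ENNReal.ofReal (2 * p.1.2) := by
    intro n p
    rw [ediam_eq_ofReal_diam isBounded_closedBall]
    exact ENNReal.ofReal_le_ofReal (diam_closedBall (ht n p p.2).1.le)
  have hlim : Tendsto (fun n : ℕ => ENNReal.ofReal (2 * (1 / ((n : ℝ) + 1)))) atTop (𝓝 0) := by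
    have := (tendsto_one_div_add_atTop_nhds_zero_nat (𝕜 := ℝ)).const_mul 2
    simpa using ENNReal.tendsto_ofReal this
  have hle := Measure.hausdorffMeasure_le_liminf_tsum (k : ℝ) (U \ N) _ hlim
    (fun n (p : t n) => closedBall p.1.1 p.1.2)
    (Eventually.of_forall fun n p => (hdiam n p).trans
      (ENNReal.ofReal_le_ofReal (by linarith [(ht n p p.2).2.1])))
    (Eventually.of_forall fun n x hx => by
      by_contra hcon
      exact hx.2 (mem_iUnion.2 ⟨n, hx.1, hcon⟩))
  have hsum : ∀ n, c * ∑' p : t n, ediam (closedBall p.1.1 p.1.2) ^ (k : ℝ) ≤ volume U := by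
    intro n
    rw [← ENNReal.tsum_mul_left]
    calc ∑' p : t n, c * ediam (closedBall p.1.1 p.1.2) ^ (k : ℝ)
        ≤ ∑' p : t n, volume (closedBall p.1.1 p.1.2) := by
          refine ENNReal.tsum_le_tsum fun p => ?_
          rw [volume_closedBall_eq_ballVolume k _ (ht n p p.2).1.le, ENNReal.rpow_natCast]
          gcongr
          exact hdiam n p
      _ = volume (⋃ p : t n, closedBall p.1.1 p.1.2) := by
          refine (measure_iUnion (fun p q hpq => ?_) fun p => measurableSet_closedBall).symm
          exact hdisj n p.2 q.2 (fun h => hpq (Subtype.ext h))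
      _ ≤ volume U := measure_mono (iUnion_subset fun p => (ht n p p.2).2.2)
  have hc0 : c ≠ 0 := by
    have : 0 < ballVolume k / 2 ^ k := div_pos (ballVolume_natCast_pos k) (by positivity)
    simpa [hcdef] using this
  rw [hausdorff, Real.rpow_natCast, Measure.smul_apply, smul_eq_mul, ← hcdef,
    ← measure_sdiff_null (s := U) hN]
  rw [mul_comm, ← ENNReal.le_div_iff_mul_le (Or.inl hc0) (Or.inl ENNReal.ofReal_ne_top)]
  refine hle.trans (liminf_le_of_frequently_le' (Frequently.of_forall fun n => ?_))
  rw [ENNReal.le_div_iff_mul_le (Or.inl hc0) (Or.inl ENNReal.ofReal_ne_top), mul_comm]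
  exact hsum n

/-- The normalized `k`-dimensional Hausdorff measure on `ℝ^k` is the Lebesgue measure. Both are
Haar measures, so it suffices that each is bounded by the other on the unit ball. -/
theorem hausdorff_eq_volume (k : ℕ) :
    (hausdorff (k : ℝ) : Measure (EuclideanSpace ℝ (Fin k))) = volume := by
  have hc : 0 < ballVolume k / 2 ^ k := div_pos (ballVolume_natCast_pos k) (by positivity)
  have hHaar : (hausdorff (k : ℝ) : Measure (EuclideanSpace ℝ (Fin k))).IsAddHaarMeasure := by
    have h0 : (Measure.hausdorffMeasure (k : ℝ) :
        Measure (EuclideanSpace ℝ (Fin k))).IsAddHaarMeasure := by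
      have : (Measure.hausdorffMeasure (Module.finrank ℝ (EuclideanSpace ℝ (Fin k)) : ℝ) :
        Measure (EuclideanSpace ℝ (Fin k))).IsAddHaarMeasure := inferInstance
      simpa using this
    rw [hausdorff, Real.rpow_natCast]
    exact Measure.IsAddHaarMeasure.smul _ (by simpa using hc) ENNReal.ofReal_ne_top
  have hU : (hausdorff (k : ℝ)) (ball (0 : EuclideanSpace ℝ (Fin k)) 1) =
      volume (ball (0 : EuclideanSpace ℝ (Fin k)) 1) :=
    le_antisymm (hausdorff_ball_le_volume k) (volume_le_hausdorff k _)
  have h := Measure.isAddLeftInvariant_eq_smul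
    (hausdorff (k : ℝ)) (volume : Measure (EuclideanSpace ℝ (Fin k)))
  rw [h, Measure.smul_apply, ENNReal.smul_def, smul_eq_mul] at hU
  have h1 := (ENNReal.mul_eq_right (measure_ball_pos volume _ one_pos).ne'
    measure_ball_lt_top.ne).1 hU
  rw [h, ENNReal.coe_eq_one.1 h1, one_smul]

end Normalization

/-! ### Volume distortion of maps close to a linear map -/

section Distortion

open Metric Filter Topology Module Measure

/-- If `g` expands distances between points of `s` at most `K` times as much as `f` does, then it
expands the Hausdorff measure of `s` at most `K ^ d` times as much. -/
lemma hausdorffMeasure_image_le_of_edist_le {X Y Z : Type*} [EMetricSpace Y]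
    [MeasurableSpace Y] [BorelSpace Y] [EMetricSpace Z] [MeasurableSpace Z] [BorelSpace Z]
    {f : X → Y} {g : X → Z} {s : Set X} {K : ℝ≥0}
    (h : ∀ x ∈ s, ∀ y ∈ s, edist (g x) (g y) ≤ K * edist (f x) (f y)) {d : ℝ} (hd : 0 ≤ d) :
    μH[d] (g '' s) ≤ (K : ℝ≥0∞) ^ d * μH[d] (f '' s) := by
  rcases s.eq_empty_or_nonempty with rfl | ⟨x₀, hx₀⟩
  · simp
  have : Nonempty X := ⟨x₀⟩
  set φ : Y → Z := fun y => g (Function.invFunOn f s y)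
  have hφ : ∀ x ∈ s, φ (f x) = g x := by
    intro x hx
    have hmem : ∃ a ∈ s, f a = f x := ⟨x, hx, rfl⟩
    have h1 := h _ (Function.invFunOn_mem hmem) _ hx
    rw [Function.invFunOn_eq hmem, edist_self, mul_zero] at h1
    exact edist_le_zero.1 h1
  have hlip : LipschitzOnWith K φ (f '' s) := by
    rintro _ ⟨x, hx, rfl⟩ _ ⟨y, hy, rfl⟩
    rw [hφ x hx, hφ y hy]
    exact h x hx y hy
  have himg : g '' s = φ '' (f '' s) := by
    rw [image_image]
    exact image_congr fun x hx => (hφ x hx).symm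
  rw [himg]
  exact hlip.hausdorffMeasure_image_le hd

variable {E F : Type*} [NormedAddCommGroup E] [InnerProductSpace ℝ E] [FiniteDimensional ℝ E]
  [NormedAddCommGroup F] [InnerProductSpace ℝ F]

lemma exists_pos_mul_norm_le_of_normDet_ne_zero {A : E →L[ℝ] F}
    (hA : (A : E →ₗ[ℝ] F).normDet ≠ 0) : ∃ c : ℝ≥0, 0 < c ∧ ∀ v, (c : ℝ) * ‖v‖ ≤ ‖A v‖ := by
  have hker : (A : E →ₗ[ℝ] F).ker = ⊥ :=
    not_not.1 (mt LinearMap.normDet_eq_zero_iff_ker_ne_bot.2 hA)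
  obtain ⟨K, hK, hAK⟩ := LinearMap.exists_antilipschitzWith (A : E →ₗ[ℝ] F) hker
  refine ⟨K⁻¹, inv_pos.2 hK, fun v => ?_⟩
  have := hAK.le_mul_norm (map_zero _) v
  rw [NNReal.coe_inv, inv_mul_le_iff₀ (by exact_mod_cast hK)]
  exact this

section

variable [MeasurableSpace E] [BorelSpace E] [MeasurableSpace F] [BorelSpace F]

/-- If `A` is bounded below by `c`, then a map which is `δ`-close to `A` expands distances at most
`1 + δ / c` times as much as `A`. -/
lemma ApproximatesLinearOn.hausdorffMeasure_image_le {f : E → F} {A : E →L[ℝ] F} {s : Set E}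
    {δ c : ℝ≥0} (hf : ApproximatesLinearOn f A s δ) (hc : 0 < c)
    (hA : ∀ v, (c : ℝ) * ‖v‖ ≤ ‖A v‖) :
    μH[finrank ℝ E] (f '' s) ≤
      ((1 + δ / c : ℝ≥0) : ℝ≥0∞) ^ finrank ℝ E *
        (ENNReal.ofReal (A : E →ₗ[ℝ] F).normDet * μH[finrank ℝ E] s) := by
  have key : ∀ x ∈ s, ∀ y ∈ s,
      edist (f x) (f y) ≤ ((1 + δ / c : ℝ≥0) : ℝ≥0∞) * edist (A x) (A y) := by
    intro x hx y hy
    rw [edist_nndist, edist_nndist, ← ENNReal.coe_mul, ENNReal.coe_le_coe, ← NNReal.coe_le_coe]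
    push_cast
    rw [dist_eq_norm, dist_eq_norm, ← map_sub]
    have h1 := hf x hx y hy
    have h2 := hA (x - y)
    have hc' : (0 : ℝ) < c := hc
    have h3 : ‖x - y‖ ≤ ‖A (x - y)‖ / c := by rw [le_div_iff₀ hc']; linarith
    calc ‖f x - f y‖ = ‖A (x - y) + (f x - f y - A (x - y))‖ := by congr 1; abel
      _ ≤ ‖A (x - y)‖ + δ * ‖x - y‖ := (norm_add_le _ _).trans (by gcongr)
      _ ≤ ‖A (x - y)‖ + δ * (‖A (x - y)‖ / c) := by gcongr
      _ = _ := by ring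
  have h := hausdorffMeasure_image_le_of_edist_le key (d := finrank ℝ E) (by positivity)
  rw [ENNReal.rpow_natCast] at h
  rw [← LinearMap.hausdorffMeasure_image]
  exact h

/-- If `A` is bounded below by `c > δ`, then `A` expands distances at most `(1 - δ / c)⁻¹` times as
much as a map which is `δ`-close to `A`. -/
lemma ApproximatesLinearOn.le_hausdorffMeasure_image {f : E → F} {A : E →L[ℝ] F} {s : Set E}
    {δ c : ℝ≥0} (hf : ApproximatesLinearOn f A s δ) (hc : 0 < c) (hδ : δ < c)
    (hA : ∀ v, (c : ℝ) * ‖v‖ ≤ ‖A v‖) :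
    ENNReal.ofReal (A : E →ₗ[ℝ] F).normDet * μH[finrank ℝ E] s ≤
      (((1 - δ / c)⁻¹ : ℝ≥0) : ℝ≥0∞) ^ finrank ℝ E * μH[finrank ℝ E] (f '' s) := by
  have key : ∀ x ∈ s, ∀ y ∈ s,
      edist (A x) (A y) ≤ (((1 - δ / c)⁻¹ : ℝ≥0) : ℝ≥0∞) * edist (f x) (f y) := by
    intro x hx y hy
    have hc' : (0 : ℝ) < c := hc
    have hlt : (δ : ℝ) / c < 1 := (div_lt_one hc').2 hδ
    have hle : δ / c ≤ 1 := by exact_mod_cast hlt.le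
    rw [edist_nndist, edist_nndist, ← ENNReal.coe_mul, ENNReal.coe_le_coe, ← NNReal.coe_le_coe]
    push_cast [hle]
    rw [dist_eq_norm, dist_eq_norm, ← map_sub, inv_mul_eq_div, le_div_iff₀ (by linarith)]
    have h1 := hf x hx y hy
    have h2 := hA (x - y)
    have h3 : ‖x - y‖ ≤ ‖A (x - y)‖ / c := by rw [le_div_iff₀ hc']; linarith
    have h4 : ‖A (x - y)‖ ≤ ‖f x - f y‖ + δ * (‖A (x - y)‖ / c) := by
      calc ‖A (x - y)‖ = ‖(f x - f y) - (f x - f y - A (x - y))‖ := by congr 1; abel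
        _ ≤ ‖f x - f y‖ + δ * ‖x - y‖ := (norm_sub_le _ _).trans (by gcongr)
        _ ≤ _ := by gcongr
    calc ‖A (x - y)‖ * (1 - δ / c) = ‖A (x - y)‖ - δ * (‖A (x - y)‖ / c) := by ring
      _ ≤ ‖f x - f y‖ := by linarith
  have h := hausdorffMeasure_image_le_of_edist_le key (d := finrank ℝ E) (by positivity)
  rw [ENNReal.rpow_natCast] at h
  rw [← LinearMap.hausdorffMeasure_image]
  exact h

/-- Let `f` be a function which is sufficiently close (in the Lipschitz sense) to a given linear
map `A`. Then it expands the Hausdorff measure of any set by at least `m` for any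
`m < A.normDet`. -/
theorem mul_le_hausdorffMeasure_image_of_lt_normDet (A : E →L[ℝ] F) {m : ℝ≥0}
    (hm : (m : ℝ≥0∞) < ENNReal.ofReal (A : E →ₗ[ℝ] F).normDet) :
    ∀ᶠ δ in 𝓝[>] (0 : ℝ≥0), ∀ (s : Set E) (f : E → F), ApproximatesLinearOn f A s δ →
      (m : ℝ≥0∞) * μH[finrank ℝ E] s ≤ μH[finrank ℝ E] (f '' s) := by
  obtain ⟨c, hc, hA⟩ := exists_pos_mul_norm_le_of_normDet_ne_zero (A := A) (by
    intro h
    simp [h] at hm)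
  refine nhdsWithin_le_nhds ?_
  set J : ℝ≥0 := (A : E →ₗ[ℝ] F).normDet.toNNReal
  have hmJ : m < J := ENNReal.coe_lt_coe.1 hm
  have hlim : Tendsto (fun δ : ℝ≥0 => m * ((1 - δ / c)⁻¹) ^ finrank ℝ E) (𝓝 0)
      (𝓝 (m * ((1 - 0 / c)⁻¹) ^ finrank ℝ E)) := by
    refine tendsto_const_nhds.mul (Tendsto.pow (Tendsto.inv₀ ?_ (by simp)) _)
    exact tendsto_const_nhds.sub (tendsto_id.div_const c)
  simp only [zero_div, tsub_zero, inv_one, one_pow, mul_one] at hlim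
  filter_upwards [hlim.eventually_lt_const hmJ, Iio_mem_nhds hc] with δ hδ hδc s f hf
  have h := hf.le_hausdorffMeasure_image hc hδc hA
  set K : ℝ≥0 := ((1 - δ / c)⁻¹) ^ finrank ℝ E
  have hK : K ≠ 0 := by
    have : δ / c < 1 := (div_lt_one hc).2 hδc
    exact pow_ne_zero _ (inv_ne_zero (tsub_pos_of_lt this).ne')
  have h2 : (K : ℝ≥0∞) * (m * μH[finrank ℝ E] s) ≤ K * μH[finrank ℝ E] (f '' s) := by
    refine le_trans ?_ (h.trans_eq (by push_cast [K]; rfl))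
    rw [← mul_assoc, ← ENNReal.coe_mul, mul_comm K m]
    exact mul_le_mul_left (ENNReal.coe_le_coe.2 hδ.le) _
  exact (ENNReal.mul_le_mul_iff_right (by simpa using hK) ENNReal.coe_ne_top).1 h2

end

/-- The graph-like map `v ↦ (A v, ε v)`, an injective perturbation of `A`. -/
def graphMap (A : E →L[ℝ] F) (ε : ℝ) : E →L[ℝ] WithLp 2 (F × E) :=
  ((WithLp.prodContinuousLinearEquiv 2 ℝ F E).symm : F × E →L[ℝ] WithLp 2 (F × E)).comp
    (A.prod (ε • ContinuousLinearMap.id ℝ E))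

variable [FiniteDimensional ℝ F]

lemma normDet_eq_sqrt (A : E →L[ℝ] F) :
    (A : E →ₗ[ℝ] F).normDet =
      √(LinearMap.det ((A : E →ₗ[ℝ] F).adjoint ∘ₗ (A : E →ₗ[ℝ] F))) := by
  rw [← LinearMap.normDet_sq, RCLike.ofReal_real_eq_id, id,
    Real.sqrt_sq (LinearMap.normDet_nonneg _)]

lemma continuous_normDet : Continuous fun A : E →L[ℝ] F => (A : E →ₗ[ℝ] F).normDet := by
  have : (fun A : E →L[ℝ] F => (A : E →ₗ[ℝ] F).normDet) =
      fun A => √((ContinuousLinearMap.adjoint A ∘L A).det) := by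
    ext A
    exact normDet_eq_sqrt A
  rw [this]
  refine Real.continuous_sqrt.comp (ContinuousLinearMap.continuous_det.comp ?_)
  exact (ContinuousLinearMap.adjoint (𝕜 := ℝ) (E := E) (F := F)).continuous.clm_comp continuous_id

lemma tendsto_normDet_graphMap (A : E →L[ℝ] F) :
    Tendsto (fun ε : ℝ => (graphMap A ε : E →ₗ[ℝ] WithLp 2 (F × E)).normDet) (𝓝 0)
      (𝓝 (A : E →ₗ[ℝ] F).normDet) := by
  have hcont : Continuous fun ε : ℝ => (graphMap A ε : E →ₗ[ℝ] WithLp 2 (F × E)).normDet := by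
    refine continuous_normDet.comp ?_
    unfold graphMap
    refine continuous_const.clm_comp ?_
    have : (fun ε : ℝ => A.prod (ε • ContinuousLinearMap.id ℝ E)) =
        fun ε : ℝ => A.prod 0 + ε • (0 : E →L[ℝ] F).prod (ContinuousLinearMap.id ℝ E) := by
      ext <;> simp
    rw [this]
    fun_prop
  have h0 : (graphMap A 0 : E →ₗ[ℝ] WithLp 2 (F × E)).normDet = (A : E →ₗ[ℝ] F).normDet := by
    rw [normDet_eq_sqrt, normDet_eq_sqrt]
    congr 2
    refine LinearMap.ext fun x => ext_inner_right ℝ fun y => ?_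
    simp [LinearMap.adjoint_inner_left, graphMap]
  rw [← h0]
  exact hcont.tendsto 0

variable [MeasurableSpace E] [BorelSpace E] [MeasurableSpace F] [BorelSpace F]

/-- Let `f` be a function which is sufficiently close (in the Lipschitz sense) to a given linear
map `A`. Then it expands the Hausdorff measure of any set by at most `m` for any
`m > A.normDet`. As `A` may fail to be injective, `f` is factored through the map
`x ↦ (f x, ε x)`, which is close to the injective linear map `v ↦ (A v, ε v)`, and the projection
`(y, x) ↦ y`, which does not increase distances. -/
theorem hausdorffMeasure_image_le_mul_of_normDet_lt (A : E →L[ℝ] F) {m : ℝ≥0}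
    (hm : ENNReal.ofReal (A : E →ₗ[ℝ] F).normDet < m) :
    ∀ᶠ δ in 𝓝[>] (0 : ℝ≥0), ∀ (s : Set E) (f : E → F), ApproximatesLinearOn f A s δ →
      μH[finrank ℝ E] (f '' s) ≤ (m : ℝ≥0∞) * μH[finrank ℝ E] s := by
  obtain ⟨ε, hεm, hε⟩ : ∃ ε : ℝ,
      ENNReal.ofReal (graphMap A ε : E →ₗ[ℝ] WithLp 2 (F × E)).normDet < m ∧ 0 < ε := by
    have h := (ENNReal.tendsto_ofReal (tendsto_normDet_graphMap A)).eventually_lt_const hm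
    exact ((h.filter_mono nhdsWithin_le_nhds).and (self_mem_nhdsWithin (s := Ioi (0 : ℝ)))).exists
  set B := graphMap A ε
  set c : ℝ≥0 := ε.toNNReal
  have hc : 0 < c := Real.toNNReal_pos.2 hε
  have hcε : (c : ℝ) = ε := Real.coe_toNNReal _ hε.le
  have hB : ∀ v, (c : ℝ) * ‖v‖ ≤ ‖B v‖ := by
    intro v
    have : ‖ε • v‖ ≤ ‖B v‖ := WithLp.norm_snd_le (x := B v)
    rwa [norm_smul, Real.norm_eq_abs, abs_of_pos hε, ← hcε] at this
  refine nhdsWithin_le_nhds ?_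
  set J : ℝ≥0 := (B : E →ₗ[ℝ] WithLp 2 (F × E)).normDet.toNNReal
  have hJm : J < m := ENNReal.coe_lt_coe.1 hεm
  have hlim : Tendsto (fun δ : ℝ≥0 => (1 + δ / c) ^ finrank ℝ E * J) (𝓝 0)
      (𝓝 ((1 + 0 / c) ^ finrank ℝ E * J)) := by
    refine Tendsto.mul (Tendsto.pow ?_ _) tendsto_const_nhds
    exact tendsto_const_nhds.add (tendsto_id.div_const c)
  simp only [zero_div, add_zero, one_pow, one_mul] at hlim
  filter_upwards [hlim.eventually_lt_const hJm] with δ hδ s f hf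
  set g : E → WithLp 2 (F × E) := fun x => WithLp.toLp 2 (f x, ε • x)
  have hg : ApproximatesLinearOn g B s δ := by
    intro x hx y hy
    have h0 : g x - g y - B (x - y) = WithLp.toLp 2 (f x - f y - A (x - y), 0) := by
      refine (WithLp.ofLp_injective 2) (Prod.ext ?_ ?_)
      · simp [g, B, graphMap]
      · simp [g, B, graphMap, smul_sub]
    rw [h0, WithLp.norm_toLp_fst]
    exact hf x hx y hy
  have h := hg.hausdorffMeasure_image_le hc hB
  have hproj : μH[finrank ℝ E] (f '' s) ≤ μH[finrank ℝ E] (g '' s) := by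
    have key : ∀ x ∈ s, ∀ y ∈ s, edist (f x) (f y) ≤ ((1 : ℝ≥0) : ℝ≥0∞) * edist (g x) (g y) := by
      intro x _ y _
      rw [ENNReal.coe_one, one_mul, edist_dist, edist_dist, dist_eq_norm, dist_eq_norm]
      exact ENNReal.ofReal_le_ofReal (WithLp.norm_fst_le (x := g x - g y))
    have := hausdorffMeasure_image_le_of_edist_le key (d := finrank ℝ E) (by positivity)
    simpa using this
  refine hproj.trans (h.trans ?_)
  rw [← mul_assoc]
  gcongr
  have : (((1 + δ / c) ^ finrank ℝ E * J : ℝ≥0) : ℝ≥0∞) ≤ m := by exact_mod_cast hδ.le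
  rw [ENNReal.coe_mul, ENNReal.coe_pow] at this
  exact this

end Distortion

/-! ### Derivatives within a set of maps between spaces of different dimensions -/

section Derivative

open Metric Filter Topology Module Measure

variable {E F : Type*} [NormedAddCommGroup E] [InnerProductSpace ℝ E]
  [NormedAddCommGroup F] [InnerProductSpace ℝ F] {s : Set E} {f : E → F} {f' : E → E →L[ℝ] F}

lemma hasFDerivWithinAt_inner_smul {L : E →L[ℝ] F} {x : E} (h : HasFDerivWithinAt f L s x)
    (u : F) (e : E) :
    HasFDerivWithinAt (fun y => inner ℝ u (f y) • e) (((innerSL ℝ u).comp L).smulRight e) s x :=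
  ((innerSL ℝ u).hasFDerivAt.comp_hasFDerivWithinAt x h).smul_const e

variable [FiniteDimensional ℝ E] [MeasurableSpace E] [BorelSpace E] (μ : Measure E)
  [IsAddHaarMeasure μ]

/-- If a differentiable function `f` is approximated by a linear map `A` on a set `s`, up to `δ`,
then at almost every `x` in `s` one has `‖f' x - A‖ ≤ δ`. The case of equal dimensions, which is
`ApproximatesLinearOn.norm_fderiv_sub_le`, is applied to the maps `x ↦ ⟪u, f x⟫ • e` from `E` to
itself, for a unit vector `e` and for `u` in a countable dense set. -/
theorem ApproximatesLinearOn.ae_norm_fderiv_sub_le [FiniteDimensional ℝ F] {A : E →L[ℝ] F}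
    {δ : ℝ≥0} (hf : ApproximatesLinearOn f A s δ) (hs : MeasurableSet s)
    (hf' : ∀ x ∈ s, HasFDerivWithinAt f (f' x) s x) : ∀ᵐ x ∂μ.restrict s, ‖f' x - A‖ ≤ δ := by
  rcases subsingleton_or_nontrivial E with hE | hE
  · refine Eventually.of_forall fun x => ?_
    rw [Subsingleton.elim (f' x - A) 0, norm_zero]
    exact δ.2
  obtain ⟨e, he⟩ := exists_norm_eq E (zero_le_one (α := ℝ))
  have h1 : ∀ u : F, ∀ᵐ x ∂μ.restrict s,
      ‖((innerSL ℝ u).comp (f' x)).smulRight e - ((innerSL ℝ u).comp A).smulRight e‖₊ ≤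
        ‖u‖₊ * δ := by
    intro u
    refine ApproximatesLinearOn.norm_fderiv_sub_le μ (f := fun y => inner ℝ u (f y) • e) ?_ hs
      (fun x => ((innerSL ℝ u).comp (f' x)).smulRight e)
      fun x hx => hasFDerivWithinAt_inner_smul (hf' x hx) u e
    intro x hx y hy
    have h0 : inner ℝ u (f x) • e - inner ℝ u (f y) • e -
        ((innerSL ℝ u).comp A).smulRight e (x - y) =
        inner ℝ u (f x - f y - A (x - y)) • e := by
      simp [inner_sub_right, sub_smul]
    rw [h0, norm_smul, he, mul_one]
    refine (norm_inner_le_norm _ _).trans ?_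
    rw [NNReal.coe_mul, coe_nnnorm, mul_assoc]
    exact mul_le_mul_of_nonneg_left (hf x hx y hy) (norm_nonneg _)
  filter_upwards [ae_all_iff.2 fun n => h1 (TopologicalSpace.denseSeq F n)] with x hx
  refine ContinuousLinearMap.opNorm_le_bound _ δ.2 fun v => ?_
  have h2 : ∀ u : F, ‖inner ℝ u ((f' x - A) v)‖ ≤ ‖u‖ * (δ * ‖v‖) := by
    intro u₀
    refine (TopologicalSpace.denseRange_denseSeq F).induction_on (p := fun u : F =>
      ‖inner ℝ u ((f' x - A) v)‖ ≤ ‖u‖ * (δ * ‖v‖)) u₀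
      (isClosed_le (by fun_prop) (by fun_prop)) fun n => ?_
    set u := TopologicalSpace.denseSeq F n
    have h3 := ContinuousLinearMap.le_of_opNorm_le _ (NNReal.coe_le_coe.2 (hx n)) v
    have h4 : (((innerSL ℝ u).comp (f' x)).smulRight e - ((innerSL ℝ u).comp A).smulRight e) v =
        inner ℝ u ((f' x - A) v) • e := by
      simp [inner_sub_right, sub_smul]
    rw [h4, norm_smul, he, mul_one, NNReal.coe_mul, coe_nnnorm, mul_assoc] at h3
    exact h3
  rcases eq_or_ne ((f' x - A) v) 0 with hz | hz
  · rw [hz, norm_zero]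
    positivity
  · have := h2 ((f' x - A) v)
    rw [real_inner_self_eq_norm_mul_norm, norm_mul, norm_norm] at this
    exact le_of_mul_le_mul_left this (norm_pos_iff.2 hz)

/-- The derivative of a function on a measurable set is almost everywhere measurable on this set.
It is recovered from the derivatives of the maps `x ↦ ⟪b i, f x⟫ • e` from `E` to itself, for an
orthonormal basis `b` of `F` and a unit vector `e`. -/
theorem aemeasurable_fderivWithin_of_finiteDimensional [FiniteDimensional ℝ F]
    (hs : MeasurableSet s) (hf' : ∀ x ∈ s, HasFDerivWithinAt f (f' x) s x) :
    AEMeasurable f' (μ.restrict s) := by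
  rcases subsingleton_or_nontrivial E with hE | hE
  · have : f' = fun _ => 0 := by
      ext x v
      simp [Subsingleton.elim v 0]
    rw [this]
    exact aemeasurable_const
  obtain ⟨e, he⟩ := exists_norm_eq E (zero_le_one (α := ℝ))
  set b := stdOrthonormalBasis ℝ F
  have hrepr : f' = fun x => ∑ i, ((innerSL ℝ e).comp
      (((innerSL ℝ (b i)).comp (f' x)).smulRight e)).smulRight (b i) := by
    ext x v
    simp only [_root_.sum_apply, ContinuousLinearMap.smulRight_apply,
      ContinuousLinearMap.comp_apply, innerSL_apply_apply, inner_smul_right,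
      real_inner_self_eq_norm_mul_norm, he, mul_one]
    exact (b.sum_repr' (f' x v)).symm
  rw [hrepr]
  refine Finset.aemeasurable_fun_sum _ fun i _ => ?_
  have hT : Continuous fun G : E →L[ℝ] E => ((innerSL ℝ e).comp G).smulRight (b i) :=
    (ContinuousLinearMap.smulRightL ℝ E F).flip (b i) |>.continuous.comp
      (continuous_const.clm_comp continuous_id)
  exact hT.measurable.comp_aemeasurable (aemeasurable_fderivWithin μ hs
    fun x hx => hasFDerivWithinAt_inner_smul (hf' x hx) (b i) e)

end Derivative

/-! ### The area formula -/

section AreaFormula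

open Metric Filter Topology Module Measure
open scoped Function

variable {E F : Type*} [NormedAddCommGroup E] [InnerProductSpace ℝ E] [FiniteDimensional ℝ E]
  [MeasurableSpace E] [BorelSpace E] [NormedAddCommGroup F] [InnerProductSpace ℝ F]
  [FiniteDimensional ℝ F] [MeasurableSpace F] [BorelSpace F]
  {s : Set E} {f : E → F} {f' : E → E →L[ℝ] F}

/-- Near each linear map `A` there is a scale `δ` at which the area factor varies by at most `ε`
and at which maps approximated by `A` distort the Hausdorff measure by `A.normDet`, up to `ε`. -/
lemma exists_pos_normDet_distortion (A : E →L[ℝ] F) {ε : ℝ≥0} (hε : 0 < ε) :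
    ∃ δ : ℝ≥0, 0 < δ ∧
      (∀ B : E →L[ℝ] F, ‖B - A‖ ≤ δ →
        |(B : E →ₗ[ℝ] F).normDet - (A : E →ₗ[ℝ] F).normDet| ≤ ε) ∧
      ∀ (t : Set E) (g : E → F), ApproximatesLinearOn g A t δ →
        μH[finrank ℝ E] (g '' t) ≤
          (ENNReal.ofReal (A : E →ₗ[ℝ] F).normDet + ε) * μH[finrank ℝ E] t ∧
        ENNReal.ofReal (A : E →ₗ[ℝ] F).normDet * μH[finrank ℝ E] t ≤
          μH[finrank ℝ E] (g '' t) + ε * μH[finrank ℝ E] t := by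
  set J : ℝ≥0 := (A : E →ₗ[ℝ] F).normDet.toNNReal
  have hJ : ENNReal.ofReal (A : E →ₗ[ℝ] F).normDet = J := rfl
  obtain ⟨δ', hδ', hδ'A⟩ := Metric.continuousAt_iff.1
    ((continuous_normDet (E := E) (F := F)).continuousAt (x := A)) ε hε
  have hsmall : ∀ᶠ δ : ℝ≥0 in 𝓝[>] (0 : ℝ≥0), (δ : ℝ) < δ' :=
    nhdsWithin_le_nhds ((NNReal.continuous_coe.tendsto 0).eventually_lt_const (by simpa using hδ'))
  have hup := hausdorffMeasure_image_le_mul_of_normDet_lt A (m := J + ε)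
    (by rw [hJ]; exact ENNReal.coe_lt_coe.2 (lt_add_of_pos_right J hε))
  have hlow : ∀ᶠ δ : ℝ≥0 in 𝓝[>] (0 : ℝ≥0), ∀ (t : Set E) (g : E → F),
      ApproximatesLinearOn g A t δ →
      (J : ℝ≥0∞) * μH[finrank ℝ E] t ≤ μH[finrank ℝ E] (g '' t) + ε * μH[finrank ℝ E] t := by
    rcases le_or_gt J ε with h | h
    -- for small area factors the error term alone is large enough
    · refine Eventually.of_forall fun δ t g _ => le_add_left ?_
      gcongr
    · have hlt : ((J - ε : ℝ≥0) : ℝ≥0∞) < ENNReal.ofReal (A : E →ₗ[ℝ] F).normDet := by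
        rw [hJ]
        exact ENNReal.coe_lt_coe.2 (tsub_lt_self (hε.trans h) hε)
      filter_upwards [mul_le_hausdorffMeasure_image_of_lt_normDet A hlt] with δ hδ t g hg
      calc (J : ℝ≥0∞) * μH[finrank ℝ E] t
          = ((J - ε : ℝ≥0) : ℝ≥0∞) * μH[finrank ℝ E] t + ε * μH[finrank ℝ E] t := by
            rw [← add_mul, ← ENNReal.coe_add, tsub_add_cancel_of_le h.le]
        _ ≤ _ := by gcongr; exact hδ t g hg
  obtain ⟨δ, ⟨⟨hδs, hδu⟩, hδl⟩, hδ⟩ :=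
    (((hsmall.and hup).and hlow).and (self_mem_nhdsWithin (s := Ioi (0 : ℝ≥0)))).exists
  refine ⟨δ, hδ, fun B hB => ?_, fun t g hg => ⟨?_, ?_⟩⟩
  · rw [← Real.dist_eq]
    exact (hδ'A (by rw [dist_eq_norm]; exact hB.trans_lt hδs)).le
  · simpa [hJ] using hδu t g hg
  · exact hδl t g hg

/-- The area formula up to an error proportional to `ε`, by summing `exists_pos_normDet_distortion`
over a countable partition of `s` on whose pieces `f` is close to linear maps. -/
lemma area_formula_approx (hs : MeasurableSet s)
    (hf' : ∀ x ∈ s, HasFDerivWithinAt f (f' x) s x) (hf : InjOn f s) {ε : ℝ≥0} (hε : 0 < ε) :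
    μH[finrank ℝ E] (f '' s) ≤
        ∫⁻ x in s, ENNReal.ofReal (f' x : E →ₗ[ℝ] F).normDet ∂μH[finrank ℝ E] +
          2 * ε * μH[finrank ℝ E] s ∧
      ∫⁻ x in s, ENNReal.ofReal (f' x : E →ₗ[ℝ] F).normDet ∂μH[finrank ℝ E] ≤
        μH[finrank ℝ E] (f '' s) + 2 * ε * μH[finrank ℝ E] s := by
  choose δ hδ0 hδB hδ using fun A : E →L[ℝ] F => exists_pos_normDet_distortion A hε
  obtain ⟨t, A, t_disj, t_meas, t_cover, ht, -⟩ :=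
    exists_partition_approximatesLinearOn_of_hasFDerivWithinAt f s f' hf' δ fun A => (hδ0 A).ne'
  set μ : Measure E := μH[finrank ℝ E]
  set ν : Measure F := μH[finrank ℝ E]
  have hst : ∀ n, MeasurableSet (s ∩ t n) := fun n => hs.inter (t_meas n)
  have hdisj : Pairwise (Disjoint on fun n => s ∩ t n) :=
    pairwise_disjoint_mono t_disj fun n => inter_subset_right
  have s_eq : s = ⋃ n, s ∩ t n := by
    rw [← inter_iUnion, inter_eq_self_of_subset_left t_cover]
  have hder : ∀ n, ∀ x ∈ s ∩ t n, HasFDerivWithinAt f (f' x) (s ∩ t n) x :=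
    fun n x hx => (hf' x hx.1).mono inter_subset_left
  have hclose : ∀ n, ∀ᵐ x ∂μ.restrict (s ∩ t n),
      |(f' x : E →ₗ[ℝ] F).normDet - (A n : E →ₗ[ℝ] F).normDet| ≤ ε := by
    intro n
    filter_upwards [(ht n).ae_norm_fderiv_sub_le μ (hst n) (hder n)] with x hx
    exact hδB (A n) _ hx
  have hν : ν (f '' s) = ∑' n, ν (f '' (s ∩ t n)) := by
    conv_lhs => rw [s_eq, image_iUnion]
    refine measure_iUnion (fun i j hij => ?_) fun n => (hst n).image_of_continuousOn_injOn
      (fun x hx => (hder n x hx).continuousWithinAt) (hf.mono inter_subset_left)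
    exact (hdisj hij).image hf inter_subset_left inter_subset_left
  have hμ : μ s = ∑' n, μ (s ∩ t n) := by
    conv_lhs => rw [s_eq]
    exact measure_iUnion hdisj hst
  have hint : ∫⁻ x in s, ENNReal.ofReal (f' x : E →ₗ[ℝ] F).normDet ∂μ =
      ∑' n, ∫⁻ x in s ∩ t n, ENNReal.ofReal (f' x : E →ₗ[ℝ] F).normDet ∂μ := by
    conv_lhs => rw [s_eq]
    exact lintegral_iUnion hst hdisj _
  have hconst : ∀ (n : ℕ) (c : ℝ≥0∞), ∫⁻ _ in s ∩ t n, c ∂μ = c * μ (s ∩ t n) :=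
    fun n c => setLIntegral_const _ _
  have hofReal : ∀ {a b : ℝ}, a ≤ b + ε → ENNReal.ofReal a ≤ ENNReal.ofReal b + ε := fun h =>
    (ENNReal.ofReal_le_ofReal h).trans (ENNReal.ofReal_add_le.trans_eq (by simp))
  have hup : ∀ n, ν (f '' (s ∩ t n)) ≤
      ∫⁻ x in s ∩ t n, ENNReal.ofReal (f' x : E →ₗ[ℝ] F).normDet ∂μ + 2 * ε * μ (s ∩ t n) := by
    intro n
    refine ((hδ (A n) _ f (ht n)).1).trans ?_
    rw [← hconst, ← hconst, ← lintegral_add_right _ measurable_const]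
    refine lintegral_mono_ae ?_
    filter_upwards [hclose n] with x hx
    rw [two_mul, ← add_assoc]
    gcongr
    exact hofReal (by linarith [(abs_le.1 hx).1])
  have hlow : ∀ n, ∫⁻ x in s ∩ t n, ENNReal.ofReal (f' x : E →ₗ[ℝ] F).normDet ∂μ ≤
      ν (f '' (s ∩ t n)) + 2 * ε * μ (s ∩ t n) := by
    intro n
    have h1 : ∫⁻ x in s ∩ t n, ENNReal.ofReal (f' x : E →ₗ[ℝ] F).normDet ∂μ ≤
        ENNReal.ofReal (A n : E →ₗ[ℝ] F).normDet * μ (s ∩ t n) + ε * μ (s ∩ t n) := by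
      rw [← add_mul, ← hconst]
      refine lintegral_mono_ae ?_
      filter_upwards [hclose n] with x hx
      exact hofReal (by linarith [(abs_le.1 hx).2])
    refine h1.trans ?_
    rw [two_mul, add_mul, ← add_assoc]
    gcongr
    exact (hδ (A n) _ f (ht n)).2
  rw [hν, hμ, hint, ← ENNReal.tsum_mul_left, ← ENNReal.tsum_add, ← ENNReal.tsum_add]
  exact ⟨ENNReal.tsum_le_tsum hup, ENNReal.tsum_le_tsum hlow⟩

/-- The **area formula** for an injective map, relative to a choice of derivatives on `s`. -/
theorem lintegral_normDet_eq_hausdorffMeasure_image (hs : MeasurableSet s)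
    (h's : μH[finrank ℝ E] s ≠ ∞) (hf' : ∀ x ∈ s, HasFDerivWithinAt f (f' x) s x)
    (hf : InjOn f s) :
    ∫⁻ x in s, ENNReal.ofReal (f' x : E →ₗ[ℝ] F).normDet ∂μH[finrank ℝ E] =
      μH[finrank ℝ E] (f '' s) := by
  have hlim : ∀ a : ℝ≥0∞,
      Tendsto (fun ε : ℝ≥0 => a + 2 * ε * μH[finrank ℝ E] s) (𝓝[>] 0) (𝓝 a) := by
    intro a
    have h : Tendsto (fun ε : ℝ≥0 => a + 2 * ε * μH[finrank ℝ E] s) (𝓝 0)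
        (𝓝 (a + 2 * ((0 : ℝ≥0) : ℝ≥0∞) * μH[finrank ℝ E] s)) :=
      tendsto_const_nhds.add (ENNReal.Tendsto.mul_const (ENNReal.Tendsto.const_mul
        (ENNReal.tendsto_coe.2 tendsto_id) (Or.inr ENNReal.ofNat_ne_top)) (Or.inr h's))
    simp only [ENNReal.coe_zero, mul_zero, zero_mul, add_zero] at h
    exact h.mono_left nhdsWithin_le_nhds
  refine le_antisymm (ge_of_tendsto (hlim _) ?_) (ge_of_tendsto (hlim _) ?_)
  · filter_upwards [self_mem_nhdsWithin] with ε hε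
    exact (area_formula_approx hs hf' hf hε).2
  · filter_upwards [self_mem_nhdsWithin] with ε hε
    exact (area_formula_approx hs hf' hf hε).1

end AreaFormula

/-! ### Push-forward under an injective continuous map -/

section Pushforward

open Filter Topology

variable {X Y : Type*} [TopologicalSpace X] [MeasurableSpace X] [BorelSpace X]
  [TopologicalSpace Y] [MeasurableSpace Y] [BorelSpace Y]
  {A : Set X} {f : X → Y} {σ : Measure X}

lemma map_eq_map_domRestrict_comap (hA : MeasurableSet A) (hf : ContinuousOn f A)
    (hσ : σ.restrict A = σ) :
    σ.map f = (σ.comap Subtype.val).map (A.domRestrict f) := by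
  have hval : (σ.comap (Subtype.val : A → X)).map Subtype.val = σ := by
    rw [(MeasurableEmbedding.subtype_coe hA).map_comap, Subtype.range_coe, hσ]
  have h := AEMeasurable.map_map_of_aemeasurable (μ := σ.comap (Subtype.val : A → X)) (g := f)
    (by rw [hval, ← hσ]; exact hf.aemeasurable hA) measurable_subtype_coe.aemeasurable
  rw [hval] at h
  exact h

variable [PolishSpace X] [T2Space Y]

/-- For a map injective on `A`, a property holds almost everywhere on the source if and only if
its transport by the inverse map holds almost everywhere on the target. By the Lusin–Souslin
theorem, this needs no measurability of the property. -/
lemma ae_map_invFunOn_iff [Nonempty X] (hA : MeasurableSet A) (hf : ContinuousOn f A)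
    (hinj : InjOn f A) (hσ : σ.restrict A = σ) {p : X → Prop} :
    (∀ᵐ y ∂σ.map f, p (Function.invFunOn f A y)) ↔ ∀ᵐ x ∂σ, p x := by
  rw [map_eq_map_domRestrict_comap hA hf hσ, (hf.measurableEmbedding hA hinj).ae_map_iff]
  have hinv : ∀ a : A, Function.invFunOn f A (A.domRestrict f a) = a :=
    fun a => hinj.leftInvOn_invFunOn a.2
  simp only [hinv]
  rw [← (MeasurableEmbedding.subtype_coe hA).ae_map_iff (p := p),
    (MeasurableEmbedding.subtype_coe hA).map_comap, Subtype.range_coe, hσ]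

lemma aemeasurable_comp_invFunOn [Nonempty X] {Z : Type*} [MeasurableSpace Z]
    (hA : MeasurableSet A) (hf : ContinuousOn f A)
    (hinj : InjOn f A) (hσ : σ.restrict A = σ) {h : X → Z} (hh : AEMeasurable h σ) :
    AEMeasurable (fun y => h (Function.invFunOn f A y)) (σ.map f) := by
  rw [map_eq_map_domRestrict_comap hA hf hσ, (hf.measurableEmbedding hA hinj).aemeasurable_map_iff]
  have hinv : (fun y => h (Function.invFunOn f A y)) ∘ A.domRestrict f = h ∘ Subtype.val := by
    ext a
    simp only [Function.comp_apply]
    rw [show Function.invFunOn f A (A.domRestrict f a) = a from hinj.leftInvOn_invFunOn a.2]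
  rw [hinv, ← (MeasurableEmbedding.subtype_coe hA).aemeasurable_map_iff,
    (MeasurableEmbedding.subtype_coe hA).map_comap, Subtype.range_coe, hσ]
  exact hh

/-- Densities are transported by the inverse map. -/
lemma map_withDensity_eq_withDensity_invFunOn [Nonempty X] (hA : MeasurableSet A)
    (hf : ContinuousOn f A) (hinj : InjOn f A) (hσ : σ.restrict A = σ) {h : X → ℝ≥0∞}
    (hh : AEMeasurable h σ) :
    (σ.withDensity h).map f =
      (σ.map f).withDensity fun y => h (Function.invFunOn f A y) := by
  have hfσ : AEMeasurable f σ := by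
    rw [← hσ]
    exact hf.aemeasurable hA
  have hfh : AEMeasurable f (σ.withDensity h) :=
    hfσ.mono_ac (withDensity_absolutelyContinuous _ _)
  have hhi := aemeasurable_comp_invFunOn hA hf hinj hσ hh
  ext T hT
  have hnull : NullMeasurableSet (f ⁻¹' T) σ := hfσ.nullMeasurable hT
  rw [Measure.map_apply_of_aemeasurable hfh hT, withDensity_apply₀ _ hnull, withDensity_apply _ hT,
    Measure.restrict_map_of_aemeasurable hfσ hT, lintegral_map' ?_ hfσ.restrict]
  · refine lintegral_congr_ae (ae_restrict_of_ae ?_)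
    have : ∀ᵐ x ∂σ, x ∈ A := by
      rw [← hσ]
      exact ae_restrict_mem hA
    filter_upwards [this] with x hx
    rw [hinj.leftInvOn_invFunOn hx]
  · rw [← Measure.restrict_map_of_aemeasurable hfσ hT]
    exact hhi.restrict

end Pushforward

/-! ### The Jacobian as a density -/

section Jacobian

open Filter Topology

variable {k d : ℕ} {A : Set (EuclideanSpace ℝ (Fin k))}
  {f : EuclideanSpace ℝ (Fin k) → EuclideanSpace ℝ (Fin d)} {C : ℝ≥0}

lemma jacobian_eq_normDet (x : EuclideanSpace ℝ (Fin k)) :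
    jacobian f A x = (fderivWithin ℝ f A x :
      EuclideanSpace ℝ (Fin k) →ₗ[ℝ] EuclideanSpace ℝ (Fin d)).normDet :=
  (normDet_eq_sqrt _).symm

/-- Rademacher's theorem, with a measurable exceptional set. -/
lemma exists_null_differentiableWithinAt (hf : LipschitzOnWith C f A) :
    ∃ N : Set (EuclideanSpace ℝ (Fin k)), MeasurableSet N ∧ volume N = 0 ∧
      ∀ x ∈ A \ N, DifferentiableWithinAt ℝ f A x := by
  have h := hf.ae_differentiableWithinAt_of_mem (μ := volume)
  refine ⟨toMeasurable volume {x | ¬ (x ∈ A → DifferentiableWithinAt ℝ f A x)},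
    measurableSet_toMeasurable _ _, by rw [measure_toMeasurable]; exact h, fun x hx => ?_⟩
  by_contra hcon
  exact hx.2 (subset_toMeasurable _ _ fun hx' => hcon (hx' hx.1))

lemma hausdorff_image_le (hf : LipschitzOnWith C f A) {B : Set (EuclideanSpace ℝ (Fin k))}
    (hB : B ⊆ A) : hausdorff (k : ℝ) (f '' B) ≤ (C : ℝ≥0∞) ^ k * volume B := by
  have h := (hf.mono hB).hausdorffMeasure_image_le (d := k) (by positivity)
  rw [ENNReal.rpow_natCast] at h
  rw [← hausdorff_eq_volume, hausdorff, hausdorff, Measure.smul_apply, Measure.smul_apply,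
    smul_eq_mul, smul_eq_mul, mul_left_comm]
  gcongr

lemma isFiniteMeasure_hausdorff_restrict_image (hA' : volume A ≠ ∞) (hf : LipschitzOnWith C f A) :
    IsFiniteMeasure ((hausdorff (k : ℝ)).restrict (f '' A)) := ⟨by
  rw [Measure.restrict_apply_univ]
  exact (hausdorff_image_le hf subset_rfl).trans_lt
    (ENNReal.mul_lt_top (ENNReal.pow_lt_top ENNReal.coe_lt_top) hA'.lt_top)⟩

lemma aemeasurable_jacobian (hA : MeasurableSet A) (hf : LipschitzOnWith C f A) :
    AEMeasurable (fun x => jacobian f A x) (volume.restrict A) := by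
  obtain ⟨N, hN, hN0, hdiff⟩ := exists_null_differentiableWithinAt hf
  have h1 : AEMeasurable (fun x => fderivWithin ℝ f A x) (volume.restrict (A \ N)) :=
    aemeasurable_fderivWithin_of_finiteDimensional volume (hA.diff hN)
      fun x hx => (hdiff x hx).hasFDerivWithinAt.mono sdiff_subset
  have h2 : (volume.restrict (A \ N) : Measure (EuclideanSpace ℝ (Fin k))) = volume.restrict A :=
    Measure.restrict_congr_set (sdiff_null_ae_eq_self hN0)
  rw [h2] at h1
  simp only [jacobian_eq_normDet]
  exact continuous_normDet.measurable.comp_aemeasurable h1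

/-- The area formula in terms of the Jacobian relative to `A`. -/
lemma setLIntegral_jacobian_eq_hausdorff_image (hf : LipschitzOnWith C f A) (hinj : InjOn f A)
    {B : Set (EuclideanSpace ℝ (Fin k))} (hB : MeasurableSet B) (hBA : B ⊆ A)
    (hB' : volume B ≠ ∞) :
    ∫⁻ x in B, ENNReal.ofReal (jacobian f A x) = hausdorff (k : ℝ) (f '' B) := by
  obtain ⟨N, hN, hN0, hdiff⟩ := exists_null_differentiableWithinAt hf
  set c := ENNReal.ofReal (ballVolume k / 2 ^ (k : ℝ))
  have hvol : (volume : Measure (EuclideanSpace ℝ (Fin k))) = c • Measure.hausdorffMeasure k :=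
    (hausdorff_eq_volume k).symm
  have hc : c ≠ 0 := by
    have : 0 < ballVolume k / 2 ^ (k : ℝ) := div_pos (ballVolume_natCast_pos k) (by positivity)
    simpa [c] using this
  have hfin : Measure.hausdorffMeasure (k : ℝ) (B \ N) ≠ ∞ := by
    intro h
    refine (measure_mono_top (s₁ := B \ N) sdiff_subset ?_).not_lt hB'.lt_top
    rw [hvol, Measure.smul_apply, h, smul_eq_mul, ENNReal.mul_top hc]
  have harea := lintegral_normDet_eq_hausdorffMeasure_image (f := f)
    (f' := fun x => fderivWithin ℝ f A x) (hB.diff hN)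
    (by rwa [finrank_euclideanSpace_fin])
    (fun x hx => ((hdiff x ⟨hBA hx.1, hx.2⟩).hasFDerivWithinAt.mono (sdiff_subset.trans hBA)))
    (hinj.mono (sdiff_subset.trans hBA))
  rw [finrank_euclideanSpace_fin] at harea
  have h1 : ∫⁻ x in B, ENNReal.ofReal (jacobian f A x) = hausdorff (k : ℝ) (f '' (B \ N)) := by
    rw [← setLIntegral_congr (sdiff_null_ae_eq_self hN0), hausdorff, Measure.smul_apply, ← harea,
      hvol, Measure.restrict_smul, lintegral_smul_measure]
    simp only [jacobian_eq_normDet]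
    rfl
  have h2 : hausdorff (k : ℝ) (f '' (B ∩ N)) = 0 := by
    have := hausdorff_image_le hf (B := B ∩ N) (inter_subset_left.trans hBA)
    rw [measure_mono_null inter_subset_right hN0, mul_zero] at this
    exact nonpos_iff_eq_zero.1 this
  rw [h1]
  refine le_antisymm (measure_mono (image_mono sdiff_subset)) ?_
  calc hausdorff (k : ℝ) (f '' B) = hausdorff (k : ℝ) (f '' (B \ N) ∪ f '' (B ∩ N)) := by
        rw [← image_union, sdiff_union_inter]
    _ ≤ _ := (measure_union_le _ _).trans_eq (by rw [h2, add_zero])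

/-- On `A` the Jacobian is a.e. at most `C ^ k`: by the area formula, its integral over `B ⊆ A` is
the Hausdorff measure of `f(B)`, which is at most `C ^ k` times the volume of `B`. -/
lemma jacobian_le_pow (hA : MeasurableSet A) (hA' : volume A ≠ ∞) (hf : LipschitzOnWith C f A)
    (hinj : InjOn f A) : ∀ᵐ x ∂volume.restrict A, jacobian f A x ≤ (C : ℝ) ^ k := by
  have hfin : IsFiniteMeasure (volume.restrict A) := ⟨by simpa using hA'.lt_top⟩
  have h := ae_le_of_forall_setLIntegral_le_of_sigmaFinite₀ (μ := volume.restrict A)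
    (f := fun x => ENNReal.ofReal (jacobian f A x)) (g := fun _ => (C : ℝ≥0∞) ^ k)
    (aemeasurable_jacobian hA hf).ennreal_ofReal (fun s hs _ => by
      rw [Measure.restrict_restrict hs, setLIntegral_jacobian_eq_hausdorff_image hf hinj
        (hs.inter hA) inter_subset_right (measure_ne_top_of_subset inter_subset_right hA'),
        setLIntegral_const]
      exact hausdorff_image_le hf inter_subset_right)
  filter_upwards [h] with x hx
  have h2 : ENNReal.ofReal (jacobian f A x) ≤ ENNReal.ofReal ((C : ℝ) ^ k) := by
    rwa [ENNReal.ofReal_pow C.coe_nonneg, ENNReal.ofReal_coe_nnreal]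
  exact (ENNReal.ofReal_le_ofReal_iff (by positivity)).1 h2

/-- The image under `f` of the measure with density `J_k f` on `A` is the Hausdorff measure on
`f(A)`. -/
lemma map_withDensity_jacobian (hA : MeasurableSet A) (hA' : volume A ≠ ∞)
    (hf : LipschitzOnWith C f A) (hinj : InjOn f A) :
    ((volume.restrict A).withDensity fun x => ENNReal.ofReal (jacobian f A x)).map f =
      (hausdorff (k : ℝ)).restrict (f '' A) := by
  classical
  set g : EuclideanSpace ℝ (Fin k) → EuclideanSpace ℝ (Fin d) := A.piecewise f fun _ => 0
  have hg : Measurable g := hf.continuousOn.measurable_piecewise continuousOn_const hA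
  have hgf : ∀ x ∈ A, g x = f x := fun x hx => piecewise_eq_of_mem A _ _ hx
  have hfg : f =ᵐ[(volume.restrict A).withDensity fun x => ENNReal.ofReal (jacobian f A x)] g := by
    refine (withDensity_absolutelyContinuous _ _).ae_le ?_
    filter_upwards [ae_restrict_mem hA] with x hx
    exact (hgf x hx).symm
  rw [Measure.map_congr hfg]
  ext T hT
  have himg : T ∩ f '' A = f '' (g ⁻¹' T ∩ A) := by
    ext y
    constructor
    · rintro ⟨hy, x, hx, rfl⟩
      exact ⟨x, ⟨by rwa [mem_preimage, hgf x hx], hx⟩, rfl⟩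
    · rintro ⟨x, ⟨hxT, hx⟩, rfl⟩
      rw [mem_preimage, hgf x hx] at hxT
      exact ⟨hxT, x, hx, rfl⟩
  rw [Measure.map_apply hg hT, withDensity_apply _ (hg hT), Measure.restrict_restrict (hg hT),
    Measure.restrict_apply hT, himg]
  exact setLIntegral_jacobian_eq_hausdorff_image hf hinj ((hg hT).inter hA) inter_subset_right
    (measure_ne_top_of_subset inter_subset_right hA')

end Jacobian

/-! ### Expectations with values in the extended reals -/

section Entropy

open Filter Topology

variable {Ω Ω' : Type*} [MeasurableSpace Ω] [MeasurableSpace Ω']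

lemma expectation_congr_ae {ρ : Measure Ω} {φ ψ : Ω → ℝ} (h : φ =ᵐ[ρ] ψ) :
    expectation ρ φ = expectation ρ ψ := by
  have h1 : ∫⁻ x, ENNReal.ofReal (φ x) ∂ρ = ∫⁻ x, ENNReal.ofReal (ψ x) ∂ρ :=
    lintegral_congr_ae (h.mono fun x hx => by simp only [hx])
  have h2 : ∫⁻ x, ENNReal.ofReal (-φ x) ∂ρ = ∫⁻ x, ENNReal.ofReal (-ψ x) ∂ρ :=
    lintegral_congr_ae (h.mono fun x hx => by simp only [hx])
  rw [expectation, expectation, h1, h2]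

lemma expectation_map {ρ : Measure Ω} {f : Ω → Ω'} (hf : AEMeasurable f ρ) {φ : Ω' → ℝ}
    (hφ : Measurable φ) : expectation (ρ.map f) φ = expectation ρ fun x => φ (f x) := by
  rw [expectation, expectation, lintegral_map' hφ.ennreal_ofReal.aemeasurable hf,
    lintegral_map' hφ.fun_neg.ennreal_ofReal.aemeasurable hf]

lemma ofReal_add_add_ofReal_neg (a b : ℝ) :
    ENNReal.ofReal (a + b) + (ENNReal.ofReal (-a) + ENNReal.ofReal (-b)) =
      ENNReal.ofReal a + ENNReal.ofReal b + ENNReal.ofReal (-(a + b)) := by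
  have h : ∀ t : ℝ, ENNReal.ofReal t = ENNReal.ofReal (max t 0) := fun t => by simp
  rw [h a, h b, h (-a), h (-b), h (a + b), h (-(a + b))]
  simp only [← ENNReal.ofReal_add, le_max_right, add_nonneg]
  congr 1
  have h2 : ∀ t : ℝ, max t 0 - max (-t) 0 = t := fun t => max_zero_sub_max_neg_zero_eq_self t
  linarith [h2 a, h2 b, h2 (a + b)]

/-- If the positive parts `a`, `p`, `q` are finite, the balance `a - a' = (p - p') + (q - q')` also
holds when some of the negative parts are infinite, both sides being `-∞` then. -/
lemma coe_sub_coe_eq_of_add_eq {a a' p p' q q' : ℝ≥0∞} (ha : a ≠ ∞) (hp : p ≠ ∞) (hq : q ≠ ∞)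
    (h : a + (p' + q') = p + q + a') :
    (a : EReal) - a' = ((p : EReal) - p') + ((q : EReal) - q') := by
  lift a to ℝ≥0 using ha
  lift p to ℝ≥0 using hp
  lift q to ℝ≥0 using hq
  have htop : ∀ r : ℝ≥0, ((r : ℝ≥0∞) : EReal) - ((∞ : ℝ≥0∞) : EReal) = ⊥ := fun r =>
    EReal.sub_top _
  rcases eq_or_ne p' ∞ with rfl | hp'
  · have : a' = ∞ := by simpa [ENNReal.add_eq_top] using h.symm
    rw [this, htop, htop, EReal.bot_add]
  rcases eq_or_ne q' ∞ with rfl | hq'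
  · have : a' = ∞ := by simpa [ENNReal.add_eq_top] using h.symm
    rw [this, htop, htop, EReal.add_bot]
  have ha' : a' ≠ ∞ := by
    rintro rfl
    rw [add_top] at h
    simp [ENNReal.add_eq_top, hp', hq'] at h
  lift a' to ℝ≥0 using ha'
  lift p' to ℝ≥0 using hp'
  lift q' to ℝ≥0 using hq'
  have h1 : (a : ℝ) + (p' + q') = p + q + a' := by exact_mod_cast h
  simp only [EReal.coe_nnreal_eq_coe_real, ← EReal.coe_sub, ← EReal.coe_add]
  have h2 : (a : ℝ) - a' = p - p' + (q - q') := by linarith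
  exact congrArg _ h2

/-- The expectation is additive on functions whose positive parts have finite integral. -/
lemma expectation_add {ρ : Measure Ω} {φ ψ : Ω → ℝ} (hφ : AEMeasurable φ ρ)
    (hψ : AEMeasurable ψ ρ) (hφ' : ∫⁻ x, ENNReal.ofReal (φ x) ∂ρ < ∞)
    (hψ' : ∫⁻ x, ENNReal.ofReal (ψ x) ∂ρ < ∞) :
    expectation ρ (fun x => φ x + ψ x) = expectation ρ φ + expectation ρ ψ := by
  refine coe_sub_coe_eq_of_add_eq ?_ hφ'.ne hψ'.ne ?_
  · refine (lt_of_le_of_lt (lintegral_mono fun x => ENNReal.ofReal_add_le) ?_).ne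
    rw [lintegral_add_left' hφ.ennreal_ofReal]
    exact ENNReal.add_lt_top.2 ⟨hφ', hψ'⟩
  · rw [← lintegral_add_left' hφ.fun_neg.ennreal_ofReal, ← lintegral_add_left' hφ.ennreal_ofReal,
      ← lintegral_add_left' (hφ.fun_add hψ).ennreal_ofReal,
      ← lintegral_add_left' (hφ.ennreal_ofReal.fun_add hψ.ennreal_ofReal)]
    exact lintegral_congr fun x => ofReal_add_add_ofReal_neg _ _

lemma measurable_negLogDensity (μ ρ : Measure Ω) : Measurable (negLogDensity μ ρ) :=
  (Real.measurable_log.comp (Measure.measurable_rnDeriv ρ μ).ennreal_toReal).neg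

/-- With respect to a finite measure, the entropy is bounded above because `-t log t ≤ 1`. -/
lemma lintegral_ofReal_negLogDensity_lt_top {μ ρ : Measure Ω} [IsFiniteMeasure μ] [SigmaFinite ρ]
    (hρ : ρ ≪ μ) : ∫⁻ x, ENNReal.ofReal (negLogDensity μ ρ x) ∂ρ < ∞ := by
  rw [← lintegral_rnDeriv_mul hρ (measurable_negLogDensity μ ρ).ennreal_ofReal.aemeasurable]
  refine lt_of_le_of_lt (lintegral_mono (g := fun _ => 1) fun x => ?_) (by simp)
  simp only [negLogDensity]
  generalize ρ.rnDeriv μ x = t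
  -- at `t = ∞` the integrand is `∞ * 0`, because of the convention `Real.log 0 = 0`
  rcases eq_or_ne t ∞ with rfl | ht
  · simp
  lift t to ℝ≥0 using ht
  rw [ENNReal.coe_toReal, ← ENNReal.ofReal_coe_nnreal, ← ENNReal.ofReal_mul t.coe_nonneg,
    ENNReal.ofReal_le_one]
  rcases eq_or_lt_of_le t.coe_nonneg with h0 | h0
  · simp [← h0]
  · have h1 := mul_le_mul_of_nonneg_left (Real.one_sub_inv_le_log_of_pos h0) h0.le
    rw [mul_sub, mul_inv_cancel₀ h0.ne'] at h1
    linarith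

lemma rnDeriv_restrict_ae_eq {μ ρ : Measure Ω} [SigmaFinite μ] [SigmaFinite ρ] {A : Set Ω}
    (hA : MeasurableSet A) (hρ : ρ ≪ μ.restrict A) :
    ρ.rnDeriv μ =ᵐ[ρ] ρ.rnDeriv (μ.restrict A) := by
  have h := Measure.rnDeriv_withDensity (ν := μ)
    ((Measure.measurable_rnDeriv ρ (μ.restrict A)).indicator hA)
  rw [withDensity_indicator hA, Measure.withDensity_rnDeriv_eq _ _ hρ] at h
  have hρμ : ρ ≪ μ := hρ.trans Measure.absolutelyContinuous_restrict
  filter_upwards [hρμ.ae_le h, hρ.ae_le (ae_restrict_mem hA)] with x hx hxA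
  rw [hx, indicator_of_mem hxA]

end Entropy

/-! ### Density and entropy of the image measure -/

section ImageMeasure

open Filter Topology

variable {k d : ℕ} {A : Set (EuclideanSpace ℝ (Fin k))}
  {f : EuclideanSpace ℝ (Fin k) → EuclideanSpace ℝ (Fin d)} {C : ℝ≥0}
  {ρ : Measure (EuclideanSpace ℝ (Fin k))}

/-- A measure on `A` living where `J_k f > 0` has density `r / J_k f` with respect to the measure
`J_k f ℒ^k` on `A`. -/
lemma withDensity_jacobian_div (hA : MeasurableSet A) (hf : LipschitzOnWith C f A)
    (hJ : ∀ᵐ x ∂ρ, 0 < jacobian f A x) {r : EuclideanSpace ℝ (Fin k) → ℝ≥0∞}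
    (hr : AEMeasurable r (volume.restrict A)) (hρr : ρ = (volume.restrict A).withDensity r) :
    ((volume.restrict A).withDensity fun x => ENNReal.ofReal (jacobian f A x)).withDensity
      (fun x => r x / ENNReal.ofReal (jacobian f A x)) = ρ := by
  have hJm := (aemeasurable_jacobian hA hf).ennreal_ofReal
  rw [← withDensity_mul₀ hJm (hr.fun_div hJm), hρr]
  rw [hρr, ae_withDensity_iff' hr] at hJ
  refine withDensity_congr_ae ?_
  filter_upwards [hJ] with x hx
  rw [Pi.mul_apply]
  -- where `J_k f = 0` also `r = 0` almost everywhere, and `0 / 0 = 0` in `ℝ≥0∞`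
  rcases eq_or_ne (r x) 0 with h0 | h0
  · rw [h0, ENNReal.zero_div, mul_zero]
  · exact ENNReal.mul_div_cancel (ENNReal.ofReal_pos.2 (hx h0)).ne' ENNReal.ofReal_ne_top

lemma restrict_withDensity_jacobian (hA : MeasurableSet A) :
    ((volume.restrict A).withDensity fun x => ENNReal.ofReal (jacobian f A x)).restrict A =
      (volume.restrict A).withDensity fun x => ENNReal.ofReal (jacobian f A x) := by
  rw [restrict_withDensity hA, Measure.restrict_restrict hA, inter_self]

lemma jacobian_invFunOn_pos (hA : MeasurableSet A) (hA' : volume A ≠ ∞)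
    (hf : LipschitzOnWith C f A) (hinj : InjOn f A) :
    ∀ᵐ y ∂((hausdorff (k : ℝ)).restrict (f '' A)),
      0 < jacobian f A (Function.invFunOn f A y) := by
  rw [← map_withDensity_jacobian hA hA' hf hinj,
    ae_map_invFunOn_iff (p := fun x => 0 < jacobian f A x) hA hf.continuousOn hinj
      (restrict_withDensity_jacobian hA),
    ae_withDensity_iff' (aemeasurable_jacobian hA hf).ennreal_ofReal]
  exact Eventually.of_forall fun x hx => ENNReal.ofReal_pos.1 (pos_iff_ne_zero.2 hx)

lemma map_eq_withDensity_div_jacobian (hA : MeasurableSet A) (hA' : volume A ≠ ∞)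
    (hf : LipschitzOnWith C f A) (hinj : InjOn f A) (hJ : ∀ᵐ x ∂ρ, 0 < jacobian f A x)
    {r : EuclideanSpace ℝ (Fin k) → ℝ≥0∞} (hr : AEMeasurable r (volume.restrict A))
    (hρr : ρ = (volume.restrict A).withDensity r) :
    AEMeasurable
        (fun y => r (Function.invFunOn f A y) /
          ENNReal.ofReal (jacobian f A (Function.invFunOn f A y)))
        ((hausdorff (k : ℝ)).restrict (f '' A)) ∧
      ρ.map f = ((hausdorff (k : ℝ)).restrict (f '' A)).withDensity
        (fun y => r (Function.invFunOn f A y) /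
          ENNReal.ofReal (jacobian f A (Function.invFunOn f A y))) := by
  have hh : AEMeasurable (fun x => r x / ENNReal.ofReal (jacobian f A x))
      ((volume.restrict A).withDensity fun x => ENNReal.ofReal (jacobian f A x)) :=
    (hr.div (aemeasurable_jacobian hA hf).ennreal_ofReal).mono_ac
      (withDensity_absolutelyContinuous _ _)
  have hσ := restrict_withDensity_jacobian (f := f) hA
  rw [← map_withDensity_jacobian hA hA' hf hinj]
  refine ⟨aemeasurable_comp_invFunOn hA hf.continuousOn hinj hσ hh, ?_⟩
  rw [← map_withDensity_eq_withDensity_invFunOn hA hf.continuousOn hinj hσ hh,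
    withDensity_jacobian_div hA hf hJ hr hρr]

/-- The logarithm of the density `(r / J_k f) ∘ f⁻¹` splits. -/
lemma negLogDensity_map_comp_ae_eq [SigmaFinite ρ] (hA : MeasurableSet A) (hA' : volume A ≠ ∞)
    (hf : LipschitzOnWith C f A) (hinj : InjOn f A) (hρ : ρ ≪ volume.restrict A)
    (hJ : ∀ᵐ x ∂ρ, 0 < jacobian f A x) :
    (fun x => negLogDensity ((hausdorff (k : ℝ)).restrict (f '' A)) (ρ.map f) (f x)) =ᵐ[ρ]
      fun x => negLogDensity volume ρ x + Real.log (jacobian f A x) := by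
  set ν : Measure (EuclideanSpace ℝ (Fin d)) := (hausdorff (k : ℝ)).restrict (f '' A)
  have hνfin : IsFiniteMeasure ν := isFiniteMeasure_hausdorff_restrict_image hA' hf
  set r := ρ.rnDeriv (volume.restrict A)
  have hr : Measurable r := Measure.measurable_rnDeriv _ _
  have hfρ : AEMeasurable f ρ := (hf.continuousOn.aemeasurable hA).mono_ac hρ
  obtain ⟨hdens, hmap⟩ := map_eq_withDensity_div_jacobian hA hA' hf hinj hJ hr.aemeasurable
    (Measure.withDensity_rnDeriv_eq _ _ hρ).symm
  have hac : ρ.map f ≪ ν := by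
    rw [hmap]
    exact withDensity_absolutelyContinuous _ _
  have h1 := Measure.rnDeriv_withDensity₀ ν hdens
  rw [← hmap] at h1
  have h2 := ae_of_ae_map hfρ (hac.ae_le h1)
  filter_upwards [h2, hρ.ae_le (ae_restrict_mem hA), hJ, Measure.rnDeriv_pos hρ,
    hρ.ae_le (Measure.rnDeriv_lt_top ρ (volume.restrict A)), rnDeriv_restrict_ae_eq hA hρ]
    with x hx hxA hxJ hpos hlt hvol
  have hrx : 0 < (r x).toReal := ENNReal.toReal_pos hpos.ne' hlt.ne
  simp only [negLogDensity]
  rw [hx, hvol, hinj.leftInvOn_invFunOn hxA, ENNReal.toReal_div, ENNReal.toReal_ofReal hxJ.le,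
    Real.log_div hrx.ne' hxJ.ne']
  ring

end ImageMeasure

/-! ### The entropy formula -/

theorem mainTheorem3 (k d : ℕ)
    (A : Set (EuclideanSpace ℝ (Fin k))) (hA : MeasurableSet A) (hAb : Bornology.IsBounded A)
    (f : EuclideanSpace ℝ (Fin k) → EuclideanSpace ℝ (Fin d))
    (hf : ∃ C : ℝ≥0, LipschitzOnWith C f A) (hinj : InjOn f A)
    (ρ : Measure (EuclideanSpace ℝ (Fin k))) [IsProbabilityMeasure ρ]
    (hρ : ρ ≪ volume.restrict A)
    (hJ : ∀ᵐ x ∂ρ, 0 < jacobian f A x) :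
    -- the image measure is absolutely continuous
    ρ.map f ≪ (hausdorff (k : ℝ)).restrict (f '' A) ∧
    -- the function `J_k f ∘ f⁻¹` is positive almost everywhere on `f(A)`
    (∀ᵐ y ∂((hausdorff (k : ℝ)).restrict (f '' A)),
      0 < jacobian f A (Function.invFunOn f A y)) ∧
    -- every density `r` of `ρ` gives the density `(r / J_k f) ∘ f⁻¹` of the image measure
    (∀ r : EuclideanSpace ℝ (Fin k) → ℝ≥0∞, AEMeasurable r (volume.restrict A) →
      ρ = (volume.restrict A).withDensity r →
      AEMeasurable
          (fun y => r (Function.invFunOn f A y) /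
            ENNReal.ofReal (jacobian f A (Function.invFunOn f A y)))
          ((hausdorff (k : ℝ)).restrict (f '' A)) ∧
        ρ.map f = ((hausdorff (k : ℝ)).restrict (f '' A)).withDensity
          (fun y => r (Function.invFunOn f A y) /
            ENNReal.ofReal (jacobian f A (Function.invFunOn f A y)))) ∧
    -- the three expectations in the entropy formula are well defined, with values in `[-∞, ∞)`
    AEMeasurable (fun x => Real.log (jacobian f A x)) ρ ∧
    ∫⁻ y, ENNReal.ofReal
      (negLogDensity ((hausdorff (k : ℝ)).restrict (f '' A)) (ρ.map f) y) ∂(ρ.map f) < ∞ ∧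
    ∫⁻ x, ENNReal.ofReal (negLogDensity volume ρ x) ∂ρ < ∞ ∧
    ∫⁻ x, ENNReal.ofReal (Real.log (jacobian f A x)) ∂ρ < ∞ ∧
    -- the entropy formula
    entropy ((hausdorff (k : ℝ)).restrict (f '' A)) (ρ.map f) =
      entropy volume ρ + expectation ρ (fun x => Real.log (jacobian f A x)) := by
  obtain ⟨C, hf⟩ := hf
  have hA' : volume A ≠ ∞ := hAb.measure_lt_top.ne
  have hvolfin : IsFiniteMeasure (volume.restrict A) := ⟨by simpa using hA'.lt_top⟩
  have hνfin : IsFiniteMeasure ((hausdorff (k : ℝ)).restrict (f '' A)) :=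
    isFiniteMeasure_hausdorff_restrict_image hA' hf
  have hfρ : AEMeasurable f ρ := (hf.continuousOn.aemeasurable hA).mono_ac hρ
  have hfprob : IsProbabilityMeasure (ρ.map f) := Measure.isProbabilityMeasure_map hfρ
  have hac : ρ.map f ≪ (hausdorff (k : ℝ)).restrict (f '' A) := by
    rw [(map_eq_withDensity_div_jacobian hA hA' hf hinj hJ
      (Measure.measurable_rnDeriv ρ (volume.restrict A)).aemeasurable
      (Measure.withDensity_rnDeriv_eq _ _ hρ).symm).2]
    exact withDensity_absolutelyContinuous _ _
  have hlogJ : AEMeasurable (fun x => Real.log (jacobian f A x)) ρ :=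
    Real.measurable_log.comp_aemeasurable ((aemeasurable_jacobian hA hf).mono_ac hρ)
  have hvol : ∫⁻ x, ENNReal.ofReal (negLogDensity volume ρ x) ∂ρ < ∞ := by
    refine lt_of_eq_of_lt (lintegral_congr_ae ?_) (lintegral_ofReal_negLogDensity_lt_top hρ)
    filter_upwards [rnDeriv_restrict_ae_eq hA hρ] with x hx
    simp only [negLogDensity, hx]
  have hJint : ∫⁻ x, ENNReal.ofReal (Real.log (jacobian f A x)) ∂ρ < ∞ := by
    refine lt_of_le_of_lt
      (lintegral_mono_ae (g := fun _ => ENNReal.ofReal (Real.log ((C : ℝ) ^ k))) ?_)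
      (by rw [lintegral_const, measure_univ, mul_one]; exact ENNReal.ofReal_lt_top)
    filter_upwards [hJ, hρ.ae_le (jacobian_le_pow hA hA' hf hinj)] with x hx hxC
    exact ENNReal.ofReal_le_ofReal (Real.log_le_log hx hxC)
  refine ⟨hac, jacobian_invFunOn_pos hA hA' hf hinj,
    fun r hr hρr => map_eq_withDensity_div_jacobian hA hA' hf hinj hJ hr hρr, hlogJ,
    lintegral_ofReal_negLogDensity_lt_top hac, hvol, hJint, ?_⟩
  rw [entropy, expectation_map hfρ (measurable_negLogDensity _ _),
    expectation_congr_ae (negLogDensity_map_comp_ae_eq hA hA' hf hinj hρ hJ),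
    expectation_add (measurable_negLogDensity _ _).aemeasurable hlogJ hvol hJint, entropy]
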